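/- Let $p\neq 2$ be a prime. Let $\phi$ and $\bar\phi$ be the two roots of $x^2-x-1$ in $K=\mathbb{Q}_p(\phi)$, where $K$ carries the unique absolute value $|\cdot|_p$ extending that of $\mathbb{Q}_p$, and put $\sqrt5:=2\phi-1$. Let $d=[K:\mathbb{Q}_p]$, let $e$ be the ramification index of $K/\mathbb{Q}_p$ (the positive integer with $\nu_p(K^\times)=\frac1e\mathbb{Z}$, where $|x|_p=p^{-\nu_p(x)}$), and let $f=d/e$. For $x\in K$ with $|x|_p=1$ let $\omega(x)$ be the unique $(p^f-1)$-st root of unity in $K$ with $|x-\omega(x)|_p<1$, and for $|x-1|_p<1$ let $\log_p x=\sum_{m\ge1}(-1)^{m+1}(x-1)^m/m$. Let $F(n)$ denote the $n$th Fibonacci number ($F(0)=0$, $F(1)=1$). For $0\le i\le p^f-2$ the series $$F_i(x)=\sum_{m\ge0}\frac{\left(\omega(\phi)^i-(-1)^m\,\omega(\bar\phi)^i\right)\left(\log_p\frac{\phi}{\omega(\phi)}\right)^m}{m!\,\sqrt5}\,x^m$$ converges for every $x\in\mathbb{Z}_p$ and defines a function $F_i:\mathbb{Z}_p\to\mathbb{Z}_p$.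 Let $A_i=\{n\ge0: n\equiv i \bmod p^f-1\}$. Then $\{(F_i,A_i):0\le i\le p^f-2\}$ is a twisted interpolation of $F(n)_{n\ge0}$ to $\mathbb{Z}_p$ (with $q=1$): the finitely many sets $A_i$ partition $\mathbb{N}$, each $A_i$ is dense in $\mathbb{Z}_p$, each $F_i$ is continuous on $\mathbb{Z}_p$, and $F(n)=F_i(n)$ for all $n\in A_i$ and all $0\le i\le p^f-2$. Here, in general, for a power $q\ge1$ of $p$, a family $\{(s_j,A_j):j\in J\}$ is a twisted interpolation to $\mathbb{Z}_p$ of a sequence $s(n)_{n\ge0}$ in $\mathbb{Z}_p$ if $J$ is finite, the sets $A_j$ partition $\mathbb{N}=\{0,1,2,\ldots\}$, each $A_j$ is a dense subset of $r+q\mathbb{Z}_p$ for some $0\le r\le q-1$, each $s_j$ is a continuous function from $\mathbb{Z}_p$ to a finite extension $K$ of $\mathbb{Q}_p$, and $s(n)=s_j(n)$ for all $j\in J$ and $n\in A_j$. -/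

import Mathlib

noncomputable section

namespace PadicInterp

/-! Throughout, a finite extension `K` of `ℚ_[p]` with its unique absolute value extending the
`p`-adic one is a normed field `K` (multiplicative norm) that is a normed algebra over `ℚ_[p]`
and is finite-dimensional. -/

/-- The inclusion of the `p`-adic integers in an extension of `ℚ_[p]`. -/
def intEmb (p : ℕ) [Fact p.Prime] (K : Type*) [NormedField K] [NormedAlgebra ℚ_[p] K] :
    ℤ_[p] →+* K :=
  (algebraMap ℚ_[p] K).comp PadicInt.Coe.ringHom

/-- The valuation `ν_p` on nonzero elements, determined by `‖x‖ = p ^ (-ν_p x)`. -/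
def ord (p : ℕ) {K : Type*} [NormedField K] (x : Kˣ) : ℝ :=
  -Real.logb p ‖(x : K)‖

/-- The ramification index: the positive integer `e` such that the image of `ν_p` is `(1/e)ℤ`. -/
def ramificationIndex (p : ℕ) (K : Type*) [NormedField K] : ℕ :=
  sInf {e : ℕ | 0 < e ∧
    Set.range (fun x : Kˣ => ord p x) = Set.range (fun k : ℤ => (k : ℝ) / (e : ℝ))}

/-- `f = d / e`, with `d` the degree of `K` over `ℚ_[p]` and `e` the ramification index. -/
def residueDegree (p : ℕ) [Fact p.Prime] (K : Type*) [NormedField K] [NormedAlgebra ℚ_[p] K] : ℕ :=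
  Module.finrank ℚ_[p] K / ramificationIndex p K

/-- `w` is a `(p ^ f - 1)`-st root of unity congruent to `x` modulo the maximal ideal of `𝒪_K`. -/
def IsRootCongruentTo (p : ℕ) [Fact p.Prime] {K : Type*} [NormedField K] [NormedAlgebra ℚ_[p] K]
    (x w : K) : Prop :=
  w ^ (p ^ residueDegree p K - 1) = 1 ∧ ‖x - w‖ < 1

open Classical in
/-- `ω(x)`: the unique `(p ^ f - 1)`-st root of unity congruent to `x` modulo the maximal ideal
(and `0` when there is none). -/
def omega (p : ℕ) [Fact p.Prime] {K : Type*} [NormedField K] [NormedAlgebra ℚ_[p] K] (x : K) : K :=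
  if h : ∃! w : K, IsRootCongruentTo p x w then h.choose else 0

/-- The terms of the `p`-adic logarithm series; the index `m` stands for the exponent `m + 1`. -/
def logTerm {K : Type*} [NormedField K] (x : K) (m : ℕ) : K :=
  (-1) ^ m * (x - 1) ^ (m + 1) / ((m + 1 : ℕ) : K)

/-- The `p`-adic logarithm `log_p x = ∑_{m ≥ 1} (-1)^(m+1) (x - 1)^m / m`. -/
def padicLog {K : Type*} [NormedField K] (x : K) : K :=
  ∑' m : ℕ, logTerm x m

/-- Twisted interpolation to `ℤ_[p]`, for a power `q` of `p`, of a sequence `s` of `p`-adic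
integers by a finite family of continuous functions `S j : ℤ_[p] → K` and sets `A j`. -/
structure IsTwistedInterpolation (p : ℕ) [Fact p.Prime] (q : ℕ) {K : Type*} [NormedField K]
    [NormedAlgebra ℚ_[p] K] {J : Type*} (s : ℕ → ℤ_[p]) (S : J → ℤ_[p] → K) (A : J → Set ℕ) :
    Prop where
  isPow : ∃ k : ℕ, q = p ^ k
  finiteExt : FiniteDimensional ℚ_[p] K
  finiteIndex : Finite J
  iUnion_eq : ⋃ j, A j = Set.univ
  pairwiseDisjoint : Pairwise fun i j => Disjoint (A i) (A j)
  /-- Each `A j` is a subset of some coset `r + q ℤ_p` and is dense in it. -/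
  isDense : ∀ j, ∃ r : ℕ, r < q ∧
    (fun n : ℕ => (n : ℤ_[p])) '' A j ⊆ Set.range (fun z : ℤ_[p] => (r : ℤ_[p]) + (q : ℤ_[p]) * z) ∧
    Set.range (fun z : ℤ_[p] => (r : ℤ_[p]) + (q : ℤ_[p]) * z) ⊆
      closure ((fun n : ℕ => (n : ℤ_[p])) '' A j)
  isContinuous : ∀ j, Continuous (S j)
  agrees : ∀ j, ∀ n ∈ A j, intEmb p K (s n) = S j (n : ℤ_[p])

/-- The `m`-th term of the power series of `F_i` at `x`, for the roots `φ`, `φ'` of `X² - X - 1`,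
with `√5 = 2 φ - 1`. -/
def fibTerm (p : ℕ) [Fact p.Prime] {K : Type*} [NormedField K] [NormedAlgebra ℚ_[p] K]
    (φ φ' : K) (i : ℕ) (x : ℤ_[p]) (m : ℕ) : K :=
  (omega p φ ^ i - (-1) ^ m * omega p φ' ^ i) * padicLog (φ / omega p φ) ^ m /
    ((m.factorial : K) * (2 * φ - 1)) * intEmb p K x ^ m

/-- The function `F_i`. -/
def fibInterp (p : ℕ) [Fact p.Prime] {K : Type*} [NormedField K] [NormedAlgebra ℚ_[p] K]
    (φ φ' : K) (i : ℕ) (x : ℤ_[p]) : K :=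
  ∑' m : ℕ, fibTerm p φ φ' i x m

end PadicInterp

end

/-! Binet's formula gives `F(n) * √5 = φ ^ n - φ' ^ n`. Powers of `φ` do not interpolate directly,
but `φ = ω(φ) * u` with `‖u - 1‖ < 1`: the factor `ω(φ) ^ n` depends only on `n` modulo `p ^ f - 1`,
and `u ^ n = exp (n * log u)` extends continuously to `ℤ_[p]`. Since `φ * φ' = -1` and, for odd `p`,
also `ω(φ) * ω(φ') = -1`, the unit attached to `φ'` is `u⁻¹`; hence the single logarithm and the
sign `(-1) ^ m` in the series.

Two facts carry the argument. Convergence: the maximal ideal lies in the disc `‖y‖ < p ^ (-1 / (p -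
1))` of the exponential as soon as `e + 1 < p` (`rate_lt_one_of_valueGroup`); here `e = 1`, or `p =
5` and `e = 2`. On that disc `exp (log u) = u` (`expSum_padicLog`). Teichmüller representatives: the
iterates `x ^ (q ^ n)`, `q = p ^ f`, converge once `x ^ q` is congruent to `x`
(`exists_pow_eq_self`). For the golden roots this congruence, and the values of `e` and `f`, come
from whether `φ` lies in `ℚ_[p]`, generates a ramified extension, or generates an unramified one.

Values lie in `ℤ_[p]` because they do on the dense set `A_i` and the image of `ℤ_[p]` in `K` is
compact. -/

open Filter Topology

namespace PadicInterp

/-! ### Norms of integers and factorials -/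

section Basic

variable (p : ℕ) [Fact p.Prime]

lemma norm_natCast_eq (K : Type*) [NormedField K] [NormedAlgebra ℚ_[p] K] (n : ℕ) :
    ‖(n : K)‖ = ‖(n : ℚ_[p])‖ := by
  rw [← map_natCast (algebraMap ℚ_[p] K) n, norm_algebraMap']

lemma norm_natCast_le_one (K : Type*) [NormedField K] [NormedAlgebra ℚ_[p] K] (n : ℕ) :
    ‖(n : K)‖ ≤ 1 := by
  rw [norm_natCast_eq p]
  exact_mod_cast Padic.norm_int_le_one (p := p) (n : ℤ)

lemma norm_prime (K : Type*) [NormedField K] [NormedAlgebra ℚ_[p] K] :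
    ‖(p : K)‖ = (p : ℝ)⁻¹ := by
  rw [norm_natCast_eq p, Padic.norm_p]

lemma norm_prime_lt_one (K : Type*) [NormedField K] [NormedAlgebra ℚ_[p] K] :
    ‖(p : K)‖ < 1 := by
  rw [norm_natCast_eq p]; exact Padic.norm_p_lt_one

lemma charZero_of_normedAlgebra (K : Type*) [NormedField K] [NormedAlgebra ℚ_[p] K] :
    CharZero K :=
  charZero_of_injective_algebraMap (algebraMap ℚ_[p] K).injective

lemma isUltrametricDist_of_normedAlgebra (K : Type*) [NormedField K] [NormedAlgebra ℚ_[p] K] :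
    IsUltrametricDist K :=
  IsUltrametricDist.isUltrametricDist_of_forall_norm_natCast_le_one (norm_natCast_le_one p K)

lemma tendsto_prime_pow (K : Type*) [NormedField K] [NormedAlgebra ℚ_[p] K] :
    Tendsto (fun k : ℕ => ((p ^ k : ℕ) : K)) atTop (𝓝 0) := by
  simpa using tendsto_pow_atTop_nhds_zero_of_norm_lt_one (norm_prime_lt_one p K)

/-- The inverse `p ^ (1 / (p - 1))` of the radius of convergence of the exponential. -/
noncomputable def expRate : ℝ := (p : ℝ) ^ ((1 : ℝ) / ((p : ℝ) - 1))

lemma expRate_pow : expRate p ^ (p - 1) = p := by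
  have h := (Fact.out : p.Prime).one_lt
  have h1 : ((p - 1 : ℕ) : ℝ) = (p : ℝ) - 1 := by push_cast [h.le]; ring
  have h2 : (1 : ℝ) < p := by exact_mod_cast h
  rw [expRate, ← Real.rpow_natCast, ← Real.rpow_mul (by positivity), h1,
    one_div_mul_cancel (by linarith), Real.rpow_one]

lemma one_le_expRate : 1 ≤ expRate p := by
  have h2 : (1 : ℝ) < p := by exact_mod_cast (Fact.out : p.Prime).one_lt
  exact Real.one_le_rpow h2.le (by apply div_nonneg <;> linarith)

lemma expRate_pos : 0 < expRate p := zero_lt_one.trans_le (one_le_expRate p)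

/-- Legendre's formula gives `(p - 1) * v_p((n + 1)!) < n + 1`, hence at most `n`. The gain of one
over the index keeps a separate factor `‖y‖` in the later bounds. -/
lemma inv_norm_factorial_le (K : Type*) [NormedField K] [NormedAlgebra ℚ_[p] K] (n : ℕ) :
    ‖((n + 1).factorial : K)‖⁻¹ ≤ expRate p ^ n := by
  have h0 : ((n + 1).factorial : ℚ) ≠ 0 := by exact_mod_cast (n + 1).factorial_ne_zero
  have h1 : ‖((n + 1).factorial : K)‖⁻¹ = (p : ℝ) ^ padicValNat p (n + 1).factorial := by
    have : ‖(((n + 1).factorial : ℚ) : ℚ_[p])‖ = _ := Padic.eq_padicNorm _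
    rw [padicNorm.eq_zpow_of_nonzero h0, padicValRat.of_nat] at this
    rw [norm_natCast_eq p]
    rw [Rat.cast_natCast] at this
    rw [this]
    push_cast
    simp
  rw [h1]
  nth_rw 1 [← expRate_pow p]
  rw [← pow_mul]
  exact pow_le_pow_right₀ (one_le_expRate p) (Nat.lt_succ_iff.mp
    (sub_one_mul_padicValNat_factorial_lt_of_ne_zero p n.succ_ne_zero))

/-- A crude bound, from `n + 1 ∣ (n + 1)!`: it suffices because the logarithm is only needed on the
disc of the exponential. -/
lemma inv_norm_natCast_succ_le (K : Type*) [NormedField K] [NormedAlgebra ℚ_[p] K] (n : ℕ) :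
    ‖((n + 1 : ℕ) : K)‖⁻¹ ≤ expRate p ^ n := by
  have := charZero_of_normedAlgebra p K
  refine le_trans ?_ (inv_norm_factorial_le p K n)
  have h0 : 0 < ‖((n + 1).factorial : K)‖ := by
    rw [norm_pos_iff]; exact_mod_cast (n + 1).factorial_ne_zero
  apply inv_anti₀ h0
  rw [Nat.factorial_succ, Nat.cast_mul, norm_mul]
  exact mul_le_of_le_one_right (norm_nonneg _) (norm_natCast_le_one p K _)

lemma norm_pow_succ_div_factorial_le {K : Type*} [NormedField K] [NormedAlgebra ℚ_[p] K] (y : K)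
    (n : ℕ) : ‖y ^ (n + 1) / ((n + 1).factorial : K)‖ ≤ ‖y‖ * (‖y‖ * expRate p) ^ n := by
  rw [norm_div, norm_pow, div_eq_mul_inv, mul_pow, pow_succ', mul_assoc]
  gcongr
  exact inv_norm_factorial_le p K n

lemma norm_pow_succ_div_succ_le {K : Type*} [NormedField K] [NormedAlgebra ℚ_[p] K] (y : K)
    (n : ℕ) : ‖y ^ (n + 1) / ((n + 1 : ℕ) : K)‖ ≤ ‖y‖ * (‖y‖ * expRate p) ^ n := by
  rw [norm_div, norm_pow, div_eq_mul_inv, mul_pow, pow_succ', mul_assoc]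
  gcongr
  exact inv_norm_natCast_succ_le p K n

lemma norm_pow_div_factorial_le {K : Type*} [NormedField K] [NormedAlgebra ℚ_[p] K] (y : K)
    (n : ℕ) : ‖y ^ n / (n.factorial : K)‖ ≤ (‖y‖ * expRate p) ^ n := by
  cases n with
  | zero => simp
  | succ n =>
    refine (norm_pow_succ_div_factorial_le p y n).trans ?_
    rw [pow_succ']
    have := one_le_expRate p
    gcongr
    exact le_mul_of_one_le_right (norm_nonneg _) this

lemma norm_rate_nonneg {K : Type*} [NormedField K] (y : K) : 0 ≤ ‖y‖ * expRate p :=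
  mul_nonneg (norm_nonneg _) (expRate_pos p).le

end Basic

/-- The exponential series of a normed field. -/
noncomputable def expSum {K : Type*} [NormedField K] (y : K) : K :=
  ∑' n : ℕ, y ^ n / (n.factorial : K)

/-! ### Exponential and logarithm series as limits of difference quotients -/

section ExpLog

variable {p : ℕ} [Fact p.Prime] {K : Type*} [NormedField K] [NormedAlgebra ℚ_[p] K]

lemma summable_norm_exp {y : K} (hy : ‖y‖ * expRate p < 1) :
    Summable fun n : ℕ => ‖y ^ n / (n.factorial : K)‖ :=
  Summable.of_nonneg_of_le (fun _ => norm_nonneg _) (norm_pow_div_factorial_le p y)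
    (summable_geometric_of_lt_one (norm_rate_nonneg p y) hy)

omit [NormedAlgebra ℚ_[p] K] in
lemma summable_rate_bound {y : K} (hy : ‖y‖ * expRate p < 1) :
    Summable fun n : ℕ => ‖y‖ * (‖y‖ * expRate p) ^ n :=
  (summable_geometric_of_lt_one (norm_rate_nonneg p y) hy).mul_left _

omit [NormedAlgebra ℚ_[p] K] in
lemma rate_bound_le {y : K} (hy : ‖y‖ * expRate p < 1) (n : ℕ) :
    ‖y‖ * (‖y‖ * expRate p) ^ n ≤ ‖y‖ :=
  mul_le_of_le_one_right (norm_nonneg _) (pow_le_one₀ (norm_rate_nonneg p y) hy.le)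

lemma norm_logTerm_le (u : K) (n : ℕ) :
    ‖logTerm u n‖ ≤ ‖u - 1‖ * (‖u - 1‖ * expRate p) ^ n := by
  rw [logTerm, mul_div_assoc, norm_mul, norm_pow, norm_neg, norm_one, one_pow, one_mul]
  exact norm_pow_succ_div_succ_le p _ n

lemma expSum_zero : expSum (0 : K) = 1 := by
  rw [expSum, tsum_eq_single 0]
  · simp
  · intro n hn; simp [hn]

variable [CompleteSpace K]

lemma expSum_eq_one_add {y : K} (hy : ‖y‖ * expRate p < 1) :
    expSum y = 1 + ∑' n : ℕ, y ^ (n + 1) / ((n + 1).factorial : K) := by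
  rw [expSum, (summable_norm_exp hy).of_norm.tsum_eq_zero_add]
  simp

lemma summable_logTerm {u : K} (hu : ‖u - 1‖ * expRate p < 1) : Summable (logTerm u) :=
  Summable.of_norm_bounded (summable_rate_bound hu) (norm_logTerm_le u)

lemma expSum_add {x y : K} (hx : ‖x‖ * expRate p < 1) (hy : ‖y‖ * expRate p < 1) :
    expSum (x + y) = expSum x * expSum y := by
  have := charZero_of_normedAlgebra p K
  have hsx := summable_norm_exp hx
  have hsy := summable_norm_exp hy
  rw [expSum, expSum, expSum, tsum_mul_tsum_eq_tsum_sum_antidiagonal_of_summable_norm hsx hsy]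
  refine tsum_congr fun n => ?_
  rw [(Commute.all x y).add_pow', Finset.sum_div]
  refine Finset.sum_congr rfl fun kl hkl => ?_
  rw [Finset.HasAntidiagonal.mem_antidiagonal] at hkl
  subst hkl
  rw [nsmul_eq_mul, Nat.cast_add_choose]
  have h0 : ∀ n : ℕ, (n.factorial : K) ≠ 0 := fun n => Nat.cast_ne_zero.mpr n.factorial_ne_zero
  have h1 := h0 kl.1
  have h2 := h0 kl.2
  have h3 := h0 (kl.1 + kl.2)
  field_simp

omit [CompleteSpace K] in
lemma rate_natCast_mul_lt {y : K} (hy : ‖y‖ * expRate p < 1) (n : ℕ) :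
    ‖(n : K) * y‖ * expRate p < 1 := by
  refine lt_of_le_of_lt ?_ hy
  rw [norm_mul]
  have := (expRate_pos p).le
  gcongr
  exact mul_le_of_le_one_left (norm_nonneg _) (norm_natCast_le_one p K n)

lemma expSum_natCast_mul {y : K} (hy : ‖y‖ * expRate p < 1) (n : ℕ) :
    expSum ((n : K) * y) = expSum y ^ n := by
  induction n with
  | zero => simp [expSum_zero]
  | succ n ih =>
    rw [Nat.cast_succ, add_mul, one_mul, expSum_add (rate_natCast_mul_lt hy n) hy, ih, pow_succ]

lemma expSum_mul_expSum_neg {y : K} (hy : ‖y‖ * expRate p < 1) :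
    expSum y * expSum (-y) = 1 := by
  rw [← expSum_add hy (by rwa [norm_neg]), add_neg_cancel, expSum_zero]

variable [IsUltrametricDist K]

omit [CompleteSpace K] in
lemma norm_padicLog_le {u : K} (hu : ‖u - 1‖ * expRate p < 1) : ‖padicLog u‖ ≤ ‖u - 1‖ :=
  IsUltrametricDist.norm_tsum_le_of_forall_le_of_nonneg (norm_nonneg _) fun n =>
    (norm_logTerm_le u n).trans (rate_bound_le hu n)

lemma norm_expSum_sub_one_le {y : K} (hy : ‖y‖ * expRate p < 1) : ‖expSum y - 1‖ ≤ ‖y‖ := by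
  rw [expSum_eq_one_add hy, add_sub_cancel_left]
  exact IsUltrametricDist.norm_tsum_le_of_forall_le_of_nonneg (norm_nonneg _) fun n =>
    (norm_pow_succ_div_factorial_le p y n).trans (rate_bound_le hy n)

omit [IsUltrametricDist K] in
-- This is the derivative of `t ↦ exp (t * y)` at `0` along `t = p ^ k`; only the linear term
-- survives, by dominated convergence.
lemma tendsto_expSum_slope {y : K} (hy : ‖y‖ * expRate p < 1) :
    Tendsto (fun k : ℕ => (expSum (((p ^ k : ℕ) : K) * y) - 1) / ((p ^ k : ℕ) : K)) atTop
      (𝓝 y) := by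
  have := charZero_of_normedAlgebra p K
  have hp0 : ∀ k : ℕ, ((p ^ k : ℕ) : K) ≠ 0 := fun k => by
    exact_mod_cast pow_ne_zero k (Fact.out : p.Prime).ne_zero
  have key : Tendsto (fun k : ℕ => ∑' n : ℕ, ((p ^ k : ℕ) : K) ^ n *
      (y ^ (n + 1) / ((n + 1).factorial : K))) atTop
      (𝓝 (∑' n : ℕ, if n = 0 then y else 0)) := by
    refine tendsto_tsum_of_dominated_convergence (summable_rate_bound hy) (fun n => ?_)
      (Eventually.of_forall fun k n => ?_)
    · cases n with
      | zero => simp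
      | succ n =>
        have := ((tendsto_prime_pow p K).pow (n + 1)).mul_const
          (y ^ (n + 1 + 1) / ((n + 1 + 1).factorial : K))
        simpa using this
    · rw [norm_mul, norm_pow]
      exact (mul_le_of_le_one_left (norm_nonneg _) (pow_le_one₀ (norm_nonneg _)
        (norm_natCast_le_one p K _))).trans (norm_pow_succ_div_factorial_le p y n)
  rw [tsum_ite_eq] at key
  refine key.congr fun k => ?_
  rw [expSum_eq_one_add (rate_natCast_mul_lt hy _), add_sub_cancel_left, ← tsum_div_const]
  refine tsum_congr fun n => ?_
  have := hp0 k
  field_simp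
  ring

omit [CompleteSpace K] [IsUltrametricDist K] in
-- The limit is the binomial coefficient of `-1` over `j`, since `p ^ k` tends to `0`. Pascal's rule
-- and absorption give the recursion in `j`.
lemma tendsto_choose_prime_pow_sub_one (j : ℕ) :
    Tendsto (fun k : ℕ => (((p ^ k - 1).choose j : ℕ) : K)) atTop (𝓝 ((-1) ^ j)) := by
  have := charZero_of_normedAlgebra p K
  have hN : ∀ k : ℕ, p ^ k - 1 + 1 = p ^ k := fun k =>
    Nat.sub_add_cancel (Nat.one_le_pow _ _ (Fact.out : p.Prime).pos)
  induction j with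
  | zero => simp
  | succ j ih =>
    have h1 : ∀ k : ℕ, (((p ^ k - 1).choose (j + 1) : ℕ) : K) =
        ((p ^ k : ℕ) : K) * ((p ^ k - 1).choose j : ℕ) / ((j + 1 : ℕ) : K)
          - ((p ^ k - 1).choose j : ℕ) := fun k => by
      have e1 := Nat.add_one_mul_choose_eq (p ^ k - 1) j
      have e2 := Nat.choose_succ_succ (p ^ k - 1) j
      rw [hN] at e1
      rw [Nat.succ_eq_add_one, hN] at e2
      have hj : ((j + 1 : ℕ) : K) ≠ 0 := by exact_mod_cast j.succ_ne_zero
      rw [← Nat.cast_mul, e1, Nat.cast_mul, mul_div_cancel_right₀ _ hj, e2]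
      push_cast; ring
    simp_rw [h1]
    have := (((tendsto_prime_pow p K).mul ih).div_const ((j + 1 : ℕ) : K)).sub ih
    simpa [pow_succ] using this

omit [IsUltrametricDist K] in
-- Expand `u = (u - 1) + 1`: the coefficient `(p ^ k).choose (n + 1) / p ^ k` equals `(p ^ k -
-- 1).choose n / (n + 1)`, which tends to the logarithm's coefficient.
lemma tendsto_pow_slope {u : K} (hu : ‖u - 1‖ * expRate p < 1) :
    Tendsto (fun k : ℕ => (u ^ p ^ k - 1) / ((p ^ k : ℕ) : K)) atTop (𝓝 (padicLog u)) := by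
  have := charZero_of_normedAlgebra p K
  have hp0 : ∀ k : ℕ, ((p ^ k : ℕ) : K) ≠ 0 := fun k => by
    exact_mod_cast pow_ne_zero k (Fact.out : p.Prime).ne_zero
  have hN : ∀ k : ℕ, p ^ k - 1 + 1 = p ^ k := fun k =>
    Nat.sub_add_cancel (Nat.one_le_pow _ _ (Fact.out : p.Prime).pos)
  have key : Tendsto (fun k : ℕ => ∑' n : ℕ, (((p ^ k - 1).choose n : ℕ) : K) *
      ((u - 1) ^ (n + 1) / ((n + 1 : ℕ) : K))) atTop (𝓝 (∑' n : ℕ, logTerm u n)) := by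
    refine tendsto_tsum_of_dominated_convergence (summable_rate_bound hu) (fun n => ?_)
      (Eventually.of_forall fun k n => ?_)
    · rw [logTerm, mul_div_assoc]
      exact (tendsto_choose_prime_pow_sub_one n).mul_const _
    · rw [norm_mul]
      exact (mul_le_of_le_one_left (norm_nonneg _) (norm_natCast_le_one p K _)).trans
        (norm_pow_succ_div_succ_le p _ n)
  refine key.congr fun k => ?_
  -- The binomial coefficients vanish from `n = p ^ k` on, so the series is the finite binomial sum.
  rw [tsum_eq_sum (s := Finset.range (p ^ k))]
  · rw [eq_div_iff (hp0 k)]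
    have h := add_pow (u - 1) 1 (p ^ k)
    rw [sub_add_cancel, Finset.sum_range_succ'] at h
    rw [h, Finset.sum_mul]
    simp only [one_pow, mul_one, pow_zero, Nat.choose_zero_right, Nat.cast_one, add_sub_cancel_right]
    refine Finset.sum_congr rfl fun n _ => ?_
    have e1 := Nat.add_one_mul_choose_eq (p ^ k - 1) n
    rw [hN] at e1
    have hj : ((n + 1 : ℕ) : K) ≠ 0 := by exact_mod_cast n.succ_ne_zero
    have e2 : ((p ^ k : ℕ) : K) * ((p ^ k - 1).choose n : ℕ) =
      ((p ^ k).choose (n + 1) : ℕ) * ((n + 1 : ℕ) : K) := by exact_mod_cast e1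
    field_simp
    linear_combination (u - 1) ^ (n + 1) * e2
  · intro n hn
    rw [Finset.mem_range, not_lt] at hn
    rw [Nat.choose_eq_zero_of_lt (by have := hN k; omega), Nat.cast_zero, zero_mul]

end ExpLog

/-! ### Behaviour of `p`-power maps: isometry near `1`, contraction of residue discs -/

section Powers

variable {p : ℕ} [Fact p.Prime] {K : Type*} [NormedField K] [NormedAlgebra ℚ_[p] K]

lemma norm_pow_pred_lt {s : K} (hs : ‖s‖ * expRate p < 1) : ‖s‖ ^ (p - 1) < ‖(p : K)‖ := by
  have hp := (Fact.out : p.Prime).one_lt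
  have h := pow_lt_one₀ (norm_rate_nonneg p s) hs (by omega : p - 1 ≠ 0)
  rw [mul_pow, expRate_pow] at h
  rw [norm_prime, ← one_div, lt_div_iff₀ (by positivity)]
  exact h

omit [NormedAlgebra ℚ_[p] K] in
lemma norm_lt_one_of_rate {s : K} (hs : ‖s‖ * expRate p < 1) : ‖s‖ < 1 :=
  (le_mul_of_one_le_right (norm_nonneg _) (one_le_expRate p)).trans_lt hs

variable [IsUltrametricDist K]

lemma norm_sub_le_max' (x y : K) : ‖x - y‖ ≤ max ‖x‖ ‖y‖ := by
  rw [sub_eq_add_neg, ← norm_neg y]; exact IsUltrametricDist.norm_add_le_max x (-y)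

lemma norm_sub_lt {x y : K} {r : ℝ} (hx : ‖x‖ < r) (hy : ‖y‖ < r) : ‖x - y‖ < r :=
  (norm_sub_le_max' x y).trans_lt (max_lt hx hy)

lemma norm_add_lt {x y : K} {r : ℝ} (hx : ‖x‖ < r) (hy : ‖y‖ < r) : ‖x + y‖ < r :=
  (IsUltrametricDist.norm_add_le_max x y).trans_lt (max_lt hx hy)

lemma norm_eq_of_norm_sub_lt {x y : K} (h : ‖x - y‖ < ‖y‖) : ‖x‖ = ‖y‖ := by
  have := IsUltrametricDist.norm_add_eq_max_of_norm_ne_norm h.ne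
  rwa [sub_add_cancel, max_eq_right h.le] at this

/-- In the expansion of `(1 + s) ^ p - 1` the term `p * s` dominates: the middle terms are divisible
by `p * s ^ 2`, and `‖s‖ ^ (p - 1) < ‖p‖` is exactly the disc condition. -/
lemma norm_pow_prime_sub_one {z : K} (hz : ‖z - 1‖ * expRate p < 1) :
    ‖z ^ p - 1‖ = ‖(p : K)‖ * ‖z - 1‖ := by
  have hpp := (Fact.out : p.Prime)
  rcases eq_or_ne z 1 with rfl | hne
  · simp
  set s := z - 1 with hs
  have hs0 : 0 < ‖s‖ := norm_pos_iff.mpr (sub_ne_zero.mpr hne)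
  have hs1 := norm_lt_one_of_rate hz
  have hpK : 0 < ‖(p : K)‖ := by rw [norm_prime]; have := hpp.pos; positivity
  obtain ⟨m, hm⟩ : ∃ m, p = m + 2 := ⟨p - 2, by have := hpp.two_le; omega⟩
  have hexp : z ^ p - 1 - (p : K) * s =
      ∑ k ∈ Finset.range m, s ^ (k + 2) * (p.choose (k + 2) : K) + s ^ p := by
    have h := add_pow s 1 p
    rw [hs, sub_add_cancel] at h
    rw [h]
    have h3 : p + 1 = m + 1 + 1 + 1 := by omega
    rw [h3, Finset.sum_range_succ', Finset.sum_range_succ', Finset.sum_range_succ]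
    have h4 : m + 1 + 1 = p := by omega
    simp [add_assoc, one_add_one_eq_two, ← hm]
    ring
  have hlt : ‖z ^ p - 1 - (p : K) * s‖ < ‖(p : K) * s‖ := by
    rw [hexp, norm_mul]
    refine norm_add_lt ?_ ?_
    · refine lt_of_le_of_lt (b := ‖(p : K)‖ * ‖s‖ ^ 2) ?_ ?_
      · refine IsUltrametricDist.norm_sum_le_of_forall_le_of_nonneg (by positivity) fun k hk => ?_
        rw [norm_mul, norm_pow, mul_comm]
        have hk' := Finset.mem_range.mp hk
        obtain ⟨r, hr⟩ := hpp.dvd_choose_self (k := k + 2) (by omega) (by omega)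
        refine mul_le_mul ?_ (pow_le_pow_of_le_one (norm_nonneg _) hs1.le (by omega))
          (by positivity) (by positivity)
        rw [hr, Nat.cast_mul, norm_mul]
        exact mul_le_of_le_one_right (norm_nonneg _) (norm_natCast_le_one p K r)
      · gcongr
        nlinarith
    · rw [norm_pow, ← Nat.sub_add_cancel hpp.one_le, pow_succ, Nat.sub_add_cancel hpp.one_le]
      gcongr
      exact norm_pow_pred_lt hz
  rw [norm_eq_of_norm_sub_lt hlt, norm_mul]

lemma norm_pow_prime_pow_sub_one {z : K} (hz : ‖z - 1‖ * expRate p < 1) (k : ℕ) :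
    ‖z ^ p ^ k - 1‖ = ‖((p ^ k : ℕ) : K)‖ * ‖z - 1‖ := by
  induction k with
  | zero => simp
  | succ k ih =>
    rw [pow_succ, pow_mul, norm_pow_prime_sub_one, ih]
    · push_cast; rw [norm_mul]; ring
    · refine lt_of_le_of_lt ?_ hz
      rw [ih]
      have := (expRate_pos p).le
      gcongr
      exact mul_le_of_le_one_left (norm_nonneg _) (norm_natCast_le_one p K _)

/-- The `p`-adic exponential inverts the logarithm on the disc of convergence. -/
theorem expSum_padicLog [CompleteSpace K] {u : K} (hu : ‖u - 1‖ * expRate p < 1) :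
    expSum (padicLog u) = u := by
  have := charZero_of_normedAlgebra p K
  have hc := (expRate_pos p).le
  have hLu := norm_padicLog_le hu
  have hL : ‖padicLog u‖ * expRate p < 1 := lt_of_le_of_lt (by gcongr) hu
  have hau : ‖expSum (padicLog u) - 1‖ ≤ ‖u - 1‖ := (norm_expSum_sub_one_le hL).trans hLu
  have hu1 : ‖u‖ = 1 := by
    rw [norm_eq_of_norm_sub_lt (y := (1 : K)) (by simpa using norm_lt_one_of_rate hu), norm_one]
  have hu0 : u ≠ 0 := norm_ne_zero_iff.mp (by rw [hu1]; exact one_ne_zero)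
  set a := expSum (padicLog u) with ha
  have hdist : ‖a / u - 1‖ = ‖a - u‖ := by
    rw [div_sub_one hu0, norm_div, hu1, div_one]
  have hz : ‖a / u - 1‖ * expRate p < 1 := by
    refine lt_of_le_of_lt ?_ hu
    gcongr
    rw [hdist, ← sub_sub_sub_cancel_right a u 1]
    exact (norm_sub_le_max' _ _).trans (max_le hau le_rfl)
  -- As `exp (p ^ k * log u) = a ^ p ^ k`, this says that `(a ^ p ^ k - u ^ p ^ k) / p ^ k` tends to
  -- `0`. Applied to `a / u`, the scaling law shows that its norm is constantly `‖a - u‖`.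
  have hlim := (tendsto_expSum_slope hL).sub (tendsto_pow_slope hu)
  rw [sub_self] at hlim
  have hconst : ∀ k : ℕ, ‖(expSum (((p ^ k : ℕ) : K) * padicLog u) - 1) / ((p ^ k : ℕ) : K) -
      (u ^ p ^ k - 1) / ((p ^ k : ℕ) : K)‖ = ‖a - u‖ := fun k => by
    have hpk : ‖((p ^ k : ℕ) : K)‖ ≠ 0 := norm_ne_zero_iff.mpr (by
      exact_mod_cast pow_ne_zero k (Fact.out : p.Prime).ne_zero)
    have h := norm_pow_prime_pow_sub_one hz k
    rw [div_pow, div_sub_one (pow_ne_zero _ hu0), norm_div, norm_pow, hu1, one_pow, div_one,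
      hdist] at h
    rw [expSum_natCast_mul hL, ← sub_div, sub_sub_sub_cancel_right, norm_div, ← ha, h,
      mul_div_cancel_left₀ _ hpk]
  have h0 := hlim.norm
  simp only [hconst, norm_zero] at h0
  have h1 := tendsto_nhds_unique tendsto_const_nhds h0
  exact sub_eq_zero.mp (norm_eq_zero.mp h1)

omit [NormedAlgebra ℚ_[p] K] in
lemma norm_pow_sub_pow_le {x y : K} (hx : ‖x‖ ≤ 1) (hy : ‖y‖ ≤ 1) (n : ℕ) :
    ‖x ^ n - y ^ n‖ ≤ ‖x - y‖ := by
  induction n with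
  | zero => simp
  | succ n ih =>
    have : x ^ (n + 1) - y ^ (n + 1) = (x ^ n - y ^ n) * x + y ^ n * (x - y) := by ring
    rw [this]
    refine (IsUltrametricDist.norm_add_le_max _ _).trans (max_le ?_ ?_)
    · rw [norm_mul]; exact (mul_le_of_le_one_right (norm_nonneg _) hx).trans ih
    · rw [norm_mul, norm_pow]
      exact mul_le_of_le_one_left (norm_nonneg _) (pow_le_one₀ (norm_nonneg _) hy)

lemma exists_add_pow_prime_eq_of_norm_le_one {x y : K} (hx : ‖x‖ ≤ 1) (hy : ‖y‖ ≤ 1) :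
    ∃ r : K, ‖r‖ ≤ 1 ∧ (x + y) ^ p = x ^ p + y ^ p + p * x * y * r := by
  refine ⟨_, ?_, add_pow_prime_eq Fact.out x y⟩
  refine IsUltrametricDist.norm_sum_le_of_forall_le_of_nonneg zero_le_one fun k _ => ?_
  rw [norm_mul, norm_mul, norm_pow, norm_pow]
  exact mul_le_one₀ (mul_le_one₀ (pow_le_one₀ (norm_nonneg _) hx) (by positivity)
    (pow_le_one₀ (norm_nonneg _) hy)) (norm_nonneg _) (norm_natCast_le_one p K _)

/-- Writing `x = (x - y) + y`, the difference is `(x - y) ^ p` plus a multiple of `p * (x - y)`;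
both are smaller than `x - y` when `‖x - y‖ < 1`. -/
lemma norm_pow_prime_sub_pow_prime_le {x y : K} (hx : ‖x‖ ≤ 1) (hy : ‖y‖ ≤ 1) :
    ‖x ^ p - y ^ p‖ ≤ max ‖(p : K)‖ ‖x - y‖ * ‖x - y‖ := by
  have hs : ‖x - y‖ ≤ 1 := (norm_sub_le_max' x y).trans (max_le hx hy)
  obtain ⟨r, hr, h⟩ := exists_add_pow_prime_eq_of_norm_le_one (p := p) hs hy
  rw [sub_add_cancel] at h
  have h2 : x ^ p - y ^ p = (x - y) ^ p + p * (x - y) * y * r := by rw [h]; ring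
  rw [h2]
  refine (IsUltrametricDist.norm_add_le_max _ _).trans (max_le ?_ ?_)
  · rw [norm_pow]
    calc ‖x - y‖ ^ p ≤ ‖x - y‖ ^ 2 :=
          pow_le_pow_of_le_one (norm_nonneg _) hs (Fact.out : p.Prime).two_le
      _ = ‖x - y‖ * ‖x - y‖ := pow_two _
      _ ≤ _ := by gcongr; exact le_max_right _ _
  · rw [norm_mul, norm_mul, norm_mul]
    calc ‖(p : K)‖ * ‖x - y‖ * ‖y‖ * ‖r‖ ≤ ‖(p : K)‖ * ‖x - y‖ * 1 * 1 := by gcongr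
      _ = ‖(p : K)‖ * ‖x - y‖ := by ring
      _ ≤ _ := by gcongr; exact le_max_left _ _

lemma norm_pow_sub_pow_contract {x y : K} (hx : ‖x‖ ≤ 1) (hy : ‖y‖ ≤ 1) {f : ℕ} (hf : f ≠ 0) :
    ‖x ^ p ^ f - y ^ p ^ f‖ ≤ max ‖(p : K)‖ ‖x - y‖ * ‖x - y‖ := by
  obtain ⟨g, rfl⟩ := Nat.exists_eq_succ_of_ne_zero hf
  rw [Nat.succ_eq_add_one, pow_succ', pow_mul, pow_mul]
  refine (norm_pow_sub_pow_le ?_ ?_ _).trans (norm_pow_prime_sub_pow_prime_le hx hy) <;>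
  · rw [norm_pow]; exact pow_le_one₀ (norm_nonneg _) ‹_›

lemma eq_of_pow_eq_self {x y : K} (hx : ‖x‖ ≤ 1) (hy : ‖y‖ ≤ 1) {f : ℕ} (hf : f ≠ 0)
    (hxq : x ^ p ^ f = x) (hyq : y ^ p ^ f = y) (hxy : ‖x - y‖ < 1) : x = y := by
  have h := norm_pow_sub_pow_contract hx hy hf (p := p)
  rw [hxq, hyq] at h
  have h1 := max_lt (norm_prime_lt_one p K) hxy
  by_contra hne
  have h2 : 0 < ‖x - y‖ := norm_pos_iff.mpr (sub_ne_zero.mpr hne)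
  nlinarith

/-- Existence of Teichmüller representatives. -/
theorem exists_pow_eq_self [CompleteSpace K] {x : K} (hx : ‖x‖ ≤ 1) {f : ℕ} (hf : f ≠ 0)
    (hxq : ‖x ^ p ^ f - x‖ < 1) : ∃ w : K, w ^ p ^ f = w ∧ ‖x - w‖ < 1 := by
  set q := p ^ f with hq
  set ρ := max ‖(p : K)‖ ‖x ^ q - x‖ with hρ
  have hρ1 : ρ < 1 := max_lt (norm_prime_lt_one p K) hxq
  have hρ0 : 0 ≤ ρ := (norm_nonneg _).trans (le_max_left _ _)
  -- Consecutive iterates approach geometrically with ratio `ρ`, and the limit is fixed by the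
  -- `q`-power map.
  let a : ℕ → K := fun n => x ^ q ^ n
  have ha1 : ∀ n, ‖a n‖ ≤ 1 := fun n => by
    simp only [a, norm_pow]; exact pow_le_one₀ (norm_nonneg _) hx
  have hstep : ∀ n, a (n + 1) = a n ^ q := fun n => by simp only [a, ← pow_mul, pow_succ]
  have hd : ∀ n, ‖a (n + 1) - a n‖ ≤ ‖x ^ q - x‖ * ρ ^ n := fun n => by
    induction n with
    | zero => simp [a]
    | succ n ih =>
      rw [hstep (n + 1), hstep n, ← hstep n]
      have h1 : a (n + 1) ^ q - a (n + 1) = a (n + 1) ^ q - a n ^ q := by rw [hstep n]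
      rw [h1]
      refine (norm_pow_sub_pow_contract (ha1 _) (ha1 _) hf).trans ?_
      rw [pow_succ, ← mul_assoc, mul_comm _ ρ]
      refine mul_le_mul (max_le (le_max_left _ _) ?_) ih (norm_nonneg _) hρ0
      exact ih.trans ((mul_le_of_le_one_right (norm_nonneg _)
        (pow_le_one₀ hρ0 hρ1.le)).trans (le_max_right _ _))
  obtain ⟨w, hw⟩ := cauchySeq_tendsto_of_complete (cauchySeq_of_le_geometric ρ ‖x ^ q - x‖ hρ1
    (f := a) fun n => by rw [dist_comm, dist_eq_norm]; exact hd n)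
  refine ⟨w, ?_, ?_⟩
  · refine tendsto_nhds_unique (hw.pow q) ?_
    simp_rw [← hstep]
    exact hw.comp (tendsto_add_atTop_nat 1)
  · have hb : ∀ n, ‖x - a n‖ ≤ ‖x ^ q - x‖ := fun n => by
      induction n with
      | zero => simp [a]
      | succ n ih =>
        rw [← sub_sub_sub_cancel_right x (a (n + 1)) (a n)]
        exact (norm_sub_le_max' _ _).trans (max_le ih ((hd n).trans
          (mul_le_of_le_one_right (norm_nonneg _) (pow_le_one₀ hρ0 hρ1.le))))
    exact (le_of_tendsto (tendsto_const_nhds.sub hw).norm (Eventually.of_forall hb)).trans_lt hxq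

end Powers

/-! ### The Teichmüller representative -/

section Omega

variable {p : ℕ} [Fact p.Prime] {K : Type*} [NormedField K] [NormedAlgebra ℚ_[p] K]

lemma prime_pow_sub_one_ne_zero {f : ℕ} (hf : f ≠ 0) : p ^ f - 1 ≠ 0 := by
  have := Nat.one_lt_pow hf (Fact.out : p.Prime).one_lt
  omega

lemma IsRootCongruentTo.norm_eq_one (hf : residueDegree p K ≠ 0) {x w : K}
    (h : IsRootCongruentTo p x w) : ‖w‖ = 1 :=
  (pow_eq_one_iff_of_nonneg (norm_nonneg w) (prime_pow_sub_one_ne_zero (p := p) hf)).mp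
    (by rw [← norm_pow, h.1, norm_one])

lemma IsRootCongruentTo.pow_eq_self {x w : K}
    (h : IsRootCongruentTo p x w) : w ^ p ^ residueDegree p K = w := by
  rw [← Nat.sub_add_cancel (Nat.one_le_pow (residueDegree p K) p (Fact.out : p.Prime).pos),
    pow_succ, h.1, one_mul]

variable [IsUltrametricDist K]

lemma IsRootCongruentTo.eq (hf : residueDegree p K ≠ 0) {x w w' : K}
    (h : IsRootCongruentTo p x w) (h' : IsRootCongruentTo p x w') : w = w' := by
  refine eq_of_pow_eq_self (h.norm_eq_one hf).le (h'.norm_eq_one hf).le hf h.pow_eq_self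
    h'.pow_eq_self ?_
  rw [← sub_sub_sub_cancel_left w' w x]
  exact norm_sub_lt h'.2 h.2

/-- Existence and uniqueness together rule out the default value `0` of `omega`. -/
lemma isRootCongruentTo_omega [CompleteSpace K] (hf : residueDegree p K ≠ 0) {x : K}
    (hx : ‖x‖ = 1) (hxq : ‖x ^ p ^ residueDegree p K - x‖ < 1) :
    IsRootCongruentTo p x (omega p x) := by
  have hex : ∃! w : K, IsRootCongruentTo p x w := by
    obtain ⟨w, hw, hxw⟩ := exists_pow_eq_self hx.le hf hxq
    have hw0 : w ≠ 0 := by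
      rintro rfl
      rw [sub_zero, hx] at hxw
      exact lt_irrefl _ hxw
    have hroot : IsRootCongruentTo p x w := by
      refine ⟨mul_right_cancel₀ hw0 ?_, hxw⟩
      rw [← pow_succ, Nat.sub_add_cancel (Nat.one_le_pow _ p (Fact.out : p.Prime).pos), hw, one_mul]
    exact ⟨w, hroot, fun w' hw' => hw'.eq hf hroot⟩
  rw [omega, dif_pos hex]
  exact hex.choose_spec.1

/-- For odd `p` the exponent `p ^ f - 1` is even, so `-1` is its own representative, and the product
represents `x * y = -1` as well. -/
lemma omega_mul_omega_eq_neg_one (hp : p ≠ 2) (hf : residueDegree p K ≠ 0) {x y : K}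
    (hx : ‖x‖ = 1) (hxy : x * y = -1) (hox : IsRootCongruentTo p x (omega p x))
    (hoy : IsRootCongruentTo p y (omega p y)) : omega p x * omega p y = -1 := by
  have h1 : IsRootCongruentTo p (-1 : K) (omega p x * omega p y) := by
    refine ⟨by rw [mul_pow, hox.1, hoy.1, one_mul], ?_⟩
    have : -1 - omega p x * omega p y = x * (y - omega p y) + (x - omega p x) * omega p y := by
      rw [← hxy]; ring
    rw [this]
    refine norm_add_lt ?_ ?_
    · rw [norm_mul, hx, one_mul]; exact hoy.2
    · rw [norm_mul, hoy.norm_eq_one hf, mul_one]; exact hox.2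
  have h2 : IsRootCongruentTo p (-1 : K) (-1 : K) := by
    refine ⟨Even.neg_one_pow ?_, by simp⟩
    exact (((Fact.out : p.Prime).odd_of_ne_two hp).pow).tsub_odd odd_one
  exact h1.eq hf h2

end Omega

/-! ### Roots of `X² - X - 1` and Binet's formula -/

section GoldenRatio

variable {K : Type*} [NormedField K] {φ φ' : K}

lemma golden_add_eq_one (hφ : φ ^ 2 - φ - 1 = 0) (hφ' : φ' ^ 2 - φ' - 1 = 0) (hne : φ' ≠ φ) :
    φ + φ' = 1 := by
  have h : (φ' - φ) * (φ + φ' - 1) = 0 := by linear_combination hφ' - hφ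
  rcases mul_eq_zero.mp h with h | h
  · exact absurd (sub_eq_zero.mp h) hne
  · linear_combination h

lemma golden_mul_eq_neg_one (hφ : φ ^ 2 - φ - 1 = 0) (hφ' : φ' ^ 2 - φ' - 1 = 0)
    (hne : φ' ≠ φ) : φ * φ' = -1 := by
  have h := golden_add_eq_one hφ hφ' hne
  linear_combination φ * h - hφ

lemma norm_golden_le_one [IsUltrametricDist K] (hφ : φ ^ 2 - φ - 1 = 0) : ‖φ‖ ≤ 1 := by
  by_contra! h
  have h1 : φ ^ 2 = φ + 1 := by linear_combination hφ
  have h2 : ‖φ‖ ^ 2 ≤ max ‖φ‖ 1 := by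
    rw [← norm_pow, h1]; simpa using IsUltrametricDist.norm_add_le_max φ 1
  rw [max_eq_left h.le] at h2
  nlinarith

/-- Both `φ` and its conjugate `1 - φ` are integral, and their product is `-1`. -/
lemma norm_golden [IsUltrametricDist K] (hφ : φ ^ 2 - φ - 1 = 0) : ‖φ‖ = 1 := by
  have hφ' : (1 - φ) ^ 2 - (1 - φ) - 1 = 0 := by linear_combination hφ
  have h1 := norm_golden_le_one hφ
  have h2 := norm_golden_le_one hφ'
  have h3 : φ * (1 - φ) = -1 := by linear_combination -hφ
  have h4 : ‖φ‖ * ‖1 - φ‖ = 1 := by rw [← norm_mul, h3, norm_neg, norm_one]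
  nlinarith [norm_nonneg φ, norm_nonneg (1 - φ)]

lemma fib_mul_sqrt_five (hφ : φ ^ 2 - φ - 1 = 0) (hφ' : φ' ^ 2 - φ' - 1 = 0) (hne : φ' ≠ φ)
    (n : ℕ) : (Nat.fib n : K) * (2 * φ - 1) = φ ^ n - φ' ^ n := by
  have hadd := golden_add_eq_one hφ hφ' hne
  induction n using Nat.twoStepInduction with
  | zero => simp
  | one => simp; linear_combination hadd
  | more n ih1 ih2 =>
    rw [Nat.fib_add_two, Nat.cast_add]
    linear_combination ih1 + ih2 - φ ^ n * hφ + φ' ^ n * hφ'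

end GoldenRatio

/-! ### Density of arithmetic progressions with modulus prime to `p` -/

section Density

variable {p : ℕ} [Fact p.Prime]

/-- The Chinese remainder theorem imposes the class modulo `N` together with any approximation
modulo `p ^ k`. -/
lemma closure_natCast_modEq {N : ℕ} (hN : p.Coprime N) (i : ℕ) :
    closure ((fun n : ℕ => (n : ℤ_[p])) '' {n : ℕ | n ≡ i [MOD N]}) = Set.univ := by
  refine Set.eq_univ_of_forall fun x => Metric.mem_closure_iff.mpr fun ε hε => ?_
  obtain ⟨k, hk⟩ := PadicInt.exists_pow_neg_lt p hε
  obtain ⟨n, hn1, hn2⟩ := Nat.chineseRemainder (hN.pow_left k) (x.appr k) i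
  refine ⟨n, ⟨n, hn2, rfl⟩, lt_of_le_of_lt ?_ hk⟩
  rw [dist_eq_norm, PadicInt.norm_le_pow_iff_mem_span_pow]
  have h1 : (n : ℤ_[p]) - (x.appr k : ℤ_[p]) ∈ Ideal.span {(p : ℤ_[p]) ^ k} := by
    rw [Ideal.mem_span_singleton]
    have := (Nat.modEq_iff_dvd.mp hn1.symm)
    have h2 := map_dvd (Int.castRingHom ℤ_[p]) this
    simpa using h2
  have := sub_mem (PadicInt.appr_spec k x) h1
  rwa [sub_sub_sub_cancel_right] at this

lemma coprime_prime_pow_sub_one {f : ℕ} (hf : f ≠ 0) : p.Coprime (p ^ f - 1) := by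
  have hp := (Fact.out : p.Prime)
  rw [hp.coprime_iff_not_dvd]
  intro h
  have h1 := (Nat.dvd_sub_iff_right (Nat.one_le_pow f p hp.pos) (dvd_pow_self p hf)).mp h
  exact hp.one_lt.ne' (Nat.dvd_one.mp h1)

end Density

/-! ### The interpolating functions -/

section Interpolation

variable {p : ℕ} [Fact p.Prime] {K : Type*} [NormedField K] [NormedAlgebra ℚ_[p] K]

lemma norm_intEmb (x : ℤ_[p]) : ‖intEmb p K x‖ = ‖x‖ := by
  change ‖algebraMap ℚ_[p] K (x : ℚ_[p])‖ = ‖x‖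
  rw [norm_algebraMap', PadicInt.norm_def]

lemma norm_intEmb_le_one (x : ℤ_[p]) : ‖intEmb p K x‖ ≤ 1 := by
  rw [norm_intEmb]; exact x.norm_le_one

lemma continuous_intEmb : Continuous (intEmb p K) :=
  (algebraMap_isometry ℚ_[p] K).continuous.comp continuous_subtype_val

lemma isClosed_range_intEmb : IsClosed (Set.range (intEmb p K)) :=
  (isCompact_range continuous_intEmb).isClosed

lemma rate_mul_intEmb_lt {y : K} (hy : ‖y‖ * expRate p < 1) (x : ℤ_[p]) :
    ‖y * intEmb p K x‖ * expRate p < 1 := by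
  refine lt_of_le_of_lt ?_ hy
  rw [norm_mul]
  have := (expRate_pos p).le
  gcongr
  exact mul_le_of_le_one_right (norm_nonneg _) (norm_intEmb_le_one x)

/-- The sign `(-1) ^ m` is absorbed into the argument, leaving two exponential series at opposite
points. -/
lemma fibTerm_eq (φ φ' : K) (i : ℕ) (x : ℤ_[p]) (m : ℕ) :
    fibTerm p φ φ' i x m = omega p φ ^ i / (2 * φ - 1) *
        ((padicLog (φ / omega p φ) * intEmb p K x) ^ m / (m.factorial : K)) -
      omega p φ' ^ i / (2 * φ - 1) *
        ((-(padicLog (φ / omega p φ) * intEmb p K x)) ^ m / (m.factorial : K)) := by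
  rw [fibTerm, neg_pow (padicLog (φ / omega p φ) * intEmb p K x), mul_pow]
  simp only [div_eq_mul_inv, mul_inv]
  ring

lemma hasSum_exp [CompleteSpace K] {y : K} (hy : ‖y‖ * expRate p < 1) :
    HasSum (fun n : ℕ => y ^ n / (n.factorial : K)) (expSum y) :=
  (summable_norm_exp hy).of_norm.hasSum

lemma hasSum_fibTerm [CompleteSpace K] {φ φ' : K}
    (hL : ‖padicLog (φ / omega p φ)‖ * expRate p < 1) (i : ℕ) (x : ℤ_[p]) :
    HasSum (fibTerm p φ φ' i x) (omega p φ ^ i / (2 * φ - 1) *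
        expSum (padicLog (φ / omega p φ) * intEmb p K x) -
      omega p φ' ^ i / (2 * φ - 1) *
        expSum (-(padicLog (φ / omega p φ) * intEmb p K x))) := by
  have h := rate_mul_intEmb_lt hL x
  have h' : ‖-(padicLog (φ / omega p φ) * intEmb p K x)‖ * expRate p < 1 := by rwa [norm_neg]
  simp_rw [funext (fibTerm_eq φ φ' i x)]
  exact ((hasSum_exp h).mul_left _).sub ((hasSum_exp h').mul_left _)

lemma continuous_expSum_mul [CompleteSpace K] {y : K} (hy : ‖y‖ * expRate p < 1) :
    Continuous fun x : ℤ_[p] => expSum (y * intEmb p K x) := by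
  refine continuous_tsum (u := fun n => (‖y‖ * expRate p) ^ n) (fun n => ?_)
    (summable_geometric_of_lt_one (norm_rate_nonneg p y) hy) (fun n x => ?_)
  · exact ((continuous_const.mul continuous_intEmb).pow n).div_const _
  · refine (norm_pow_div_factorial_le p _ n).trans ?_
    have := (expRate_pos p).le
    refine pow_le_pow_left₀ (norm_rate_nonneg p _) ?_ n
    rw [norm_mul]
    gcongr
    exact mul_le_of_le_one_right (norm_nonneg _) (norm_intEmb_le_one x)

lemma continuous_fibInterp [CompleteSpace K] {φ φ' : K}
    (hL : ‖padicLog (φ / omega p φ)‖ * expRate p < 1) (i : ℕ) :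
    Continuous (fibInterp p φ φ' i) := by
  have h : fibInterp p φ φ' i = fun x => omega p φ ^ i / (2 * φ - 1) *
        expSum (padicLog (φ / omega p φ) * intEmb p K x) -
      omega p φ' ^ i / (2 * φ - 1) *
        expSum (-padicLog (φ / omega p φ) * intEmb p K x) := by
    funext x
    rw [neg_mul]
    exact (hasSum_fibTerm hL i x).tsum_eq
  rw [h]
  exact (continuous_const.mul (continuous_expSum_mul hL)).sub
    (continuous_const.mul (continuous_expSum_mul (by rwa [norm_neg])))

lemma fibInterp_natCast [CompleteSpace K] [IsUltrametricDist K] {φ φ' : K}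
    (hφ : φ ^ 2 - φ - 1 = 0) (hφ' : φ' ^ 2 - φ' - 1 = 0) (hne : φ' ≠ φ)
    (hω : omega p φ ^ (p ^ residueDegree p K - 1) = 1)
    (hω' : omega p φ' ^ (p ^ residueDegree p K - 1) = 1)
    (hωω' : omega p φ * omega p φ' = -1)
    (hu : ‖φ / omega p φ - 1‖ * expRate p < 1) {i n : ℕ}
    (hn : n ≡ i [MOD p ^ residueDegree p K - 1]) :
    fibInterp p φ φ' i (n : ℤ_[p]) = (Nat.fib n : K) := by
  have hL : ‖padicLog (φ / omega p φ)‖ * expRate p < 1 := by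
    refine lt_of_le_of_lt ?_ hu
    have := (expRate_pos p).le
    gcongr
    exact norm_padicLog_le hu
  have hs : 2 * φ - 1 ≠ 0 := fun h => hne (by
    linear_combination golden_add_eq_one hφ hφ' hne - h)
  have hw : omega p φ ≠ 0 := fun h => by simp [h] at hωω'
  have hw' : omega p φ' ≠ 0 := fun h => by simp [h] at hωω'
  have hφ0 : φ ≠ 0 := fun h => by simp [h] at hφ
  have hmul := golden_mul_eq_neg_one hφ hφ' hne
  rw [fibInterp, (hasSum_fibTerm hL i _).tsum_eq, map_natCast,
    ← pow_eq_pow_of_modEq hn hω, ← pow_eq_pow_of_modEq hn hω']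
  have h1 : expSum (padicLog (φ / omega p φ) * (n : K)) = (φ / omega p φ) ^ n := by
    rw [mul_comm, expSum_natCast_mul hL, expSum_padicLog hu]
  have h2 : expSum (-(padicLog (φ / omega p φ) * (n : K))) = (φ' / omega p φ') ^ n := by
    have h3 := expSum_mul_expSum_neg (p := p) (y := padicLog (φ / omega p φ) * (n : K))
      (by rw [mul_comm (padicLog _)]; exact rate_natCast_mul_lt hL n)
    rw [h1] at h3
    -- `φ' / ω(φ')` is the inverse of `φ / ω(φ)`, so its powers are `exp` at the opposite argument.
    have h4 : (φ / omega p φ) ^ n * (φ' / omega p φ') ^ n = 1 := by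
      rw [← mul_pow, div_mul_div_comm, hmul, hωω', div_self (by simp), one_pow]
    exact mul_left_cancel₀ (pow_ne_zero n (div_ne_zero hφ0 hw)) (h3.trans h4.symm)
  rw [h1, h2, div_pow, div_pow]
  field_simp
  rw [mul_comm]
  linear_combination -fib_mul_sqrt_five hφ hφ' hne n

/-- The twisted interpolation of the Fibonacci numbers, given that `φ` and `φ'` are fixed by the
`p ^ f`-power map modulo the maximal ideal and that the maximal ideal lies in the disc of
convergence of the exponential. -/
theorem fib_twistedInterpolation_of_residueDegree (hp : p ≠ 2) [FiniteDimensional ℚ_[p] K]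
    {φ φ' : K}
    (hφ : φ ^ 2 - φ - 1 = 0) (hφ' : φ' ^ 2 - φ' - 1 = 0) (hne : φ' ≠ φ)
    (hf : residueDegree p K ≠ 0) (hrate : ∀ t : K, ‖t‖ < 1 → ‖t‖ * expRate p < 1)
    (hφq : ‖φ ^ p ^ residueDegree p K - φ‖ < 1)
    (hφq' : ‖φ' ^ p ^ residueDegree p K - φ'‖ < 1) :
    (IsRootCongruentTo p φ (omega p φ) ∧ IsRootCongruentTo p φ' (omega p φ') ∧
      ‖φ / omega p φ - 1‖ < 1 ∧ Summable (logTerm (φ / omega p φ))) ∧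
    (∀ i : ℕ, i < p ^ residueDegree p K - 1 → ∀ x : ℤ_[p],
      Summable (fibTerm p φ φ' i x) ∧ ∃ y : ℤ_[p], fibInterp p φ φ' i x = intEmb p K y) ∧
    IsTwistedInterpolation p 1 (fun n : ℕ => (Nat.fib n : ℤ_[p]))
      (fun i : Fin (p ^ residueDegree p K - 1) => fibInterp p φ φ' i)
      (fun i : Fin (p ^ residueDegree p K - 1) =>
        {n : ℕ | n ≡ i [MOD p ^ residueDegree p K - 1]}) := by
  have := isUltrametricDist_of_normedAlgebra p K
  have : CompleteSpace K := FiniteDimensional.complete ℚ_[p] K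
  have hω := isRootCongruentTo_omega hf (norm_golden hφ) hφq
  have hω' := isRootCongruentTo_omega hf (norm_golden hφ') hφq'
  have hωω' := omega_mul_omega_eq_neg_one hp hf (norm_golden hφ)
    (golden_mul_eq_neg_one hφ hφ' hne) hω hω'
  have hw := hω.norm_eq_one hf
  have hw0 : omega p φ ≠ 0 := norm_ne_zero_iff.mp (by rw [hw]; exact one_ne_zero)
  have hu1 : ‖φ / omega p φ - 1‖ < 1 := by
    rw [div_sub_one hw0, norm_div, hw, div_one]; exact hω.2
  have hu := hrate _ hu1
  have hL : ‖padicLog (φ / omega p φ)‖ * expRate p < 1 :=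
    hrate _ ((norm_padicLog_le hu).trans_lt hu1)
  have hN := prime_pow_sub_one_ne_zero (p := p) hf
  have hval : ∀ i n : ℕ, n ≡ i [MOD p ^ residueDegree p K - 1] →
      fibInterp p φ φ' i (n : ℤ_[p]) = (Nat.fib n : K) := fun i n hn =>
    fibInterp_natCast hφ hφ' hne hω.1 hω'.1 hωω' hu hn
  have hdense := fun i : ℕ => closure_natCast_modEq (p := p) (coprime_prime_pow_sub_one hf) i
  refine ⟨⟨hω, hω', hu1, summable_logTerm hu⟩, fun i _ x => ⟨(hasSum_fibTerm hL i x).summable, ?_⟩,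
    ⟨0, by simp⟩, inferInstance, inferInstance, ?_, ?_, fun i => ⟨0, one_pos, ?_, ?_⟩,
    fun i => continuous_fibInterp hL i, fun i n hn => ?_⟩
  -- The preimage of the closed image of `ℤ_[p]` is closed and contains a dense set.
  · have hsub : closure ((fun n : ℕ => (n : ℤ_[p])) '' {n : ℕ | n ≡ i [MOD _]}) ⊆
        fibInterp p φ φ' i ⁻¹' Set.range (intEmb p K) :=
      closure_minimal (by
        rintro _ ⟨n, hn, rfl⟩
        exact ⟨(Nat.fib n : ℤ_[p]), by rw [hval i n hn, map_natCast]⟩)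
        (isClosed_range_intEmb.preimage (continuous_fibInterp hL i))
    rw [hdense] at hsub
    obtain ⟨y, hy⟩ := hsub (Set.mem_univ x)
    exact ⟨y, hy.symm⟩
  · refine Set.eq_univ_of_forall fun n => Set.mem_iUnion.mpr
      ⟨⟨n % (p ^ residueDegree p K - 1), Nat.mod_lt _ (Nat.pos_of_ne_zero hN)⟩, ?_⟩
    exact (Nat.mod_modEq _ _).symm
  · intro i j hij
    refine Set.disjoint_left.mpr fun n hi hj => hij (Fin.ext ?_)
    have hi' : n ≡ i [MOD p ^ residueDegree p K - 1] := hi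
    exact Nat.ModEq.eq_of_lt_of_lt (hi'.symm.trans hj) i.2 j.2
  · rintro x -
    exact ⟨x, by simp⟩
  · rw [hdense]; exact Set.subset_univ _
  · rw [hval i n hn, map_natCast]

end Interpolation

/-! ### Ramification index and the disc of convergence -/

section ValueGroup

variable {p : ℕ} [Fact p.Prime] {K : Type*} [NormedField K]

/-- The first hypothesis bounds the value group by `(1/e)ℤ`, the second supplies a generator. The
set under `sInf` is then a singleton, as `(1/a)ℤ ⊆ (1/b)ℤ` forces `a ∣ b`. -/
lemma ramificationIndex_eq {e : ℕ} (he : e ≠ 0)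
    (h : ∀ x : K, x ≠ 0 → ∃ k : ℤ, ‖x‖ ^ e = (p : ℝ) ^ k)
    (hπ : ∃ π : K, ‖π‖ ^ e = (p : ℝ)⁻¹) : ramificationIndex p K = e := by
  have hp1 : (1 : ℝ) < p := by exact_mod_cast (Fact.out : p.Prime).one_lt
  have hlog : Real.log p ≠ 0 := (Real.log_pos hp1).ne'
  have he' : (e : ℝ) ≠ 0 := by exact_mod_cast he
  have hord : ∀ (x : Kˣ) (k : ℤ), ‖(x : K)‖ ^ e = (p : ℝ) ^ k → ord p x = (-k : ℤ) / (e : ℝ) := by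
    intro x k hx
    have h1 := congrArg (Real.logb p) hx
    rw [Real.logb_pow, ← Real.rpow_intCast, Real.logb_rpow (by linarith) hp1.ne'] at h1
    rw [ord, eq_div_iff he']
    push_cast
    linarith
  have hrange : Set.range (fun x : Kˣ => ord p x) = Set.range (fun k : ℤ => (k : ℝ) / (e : ℝ)) := by
    ext r
    constructor
    · rintro ⟨x, rfl⟩
      obtain ⟨k, hk⟩ := h x x.ne_zero
      exact ⟨-k, (hord x k hk).symm⟩
    · rintro ⟨k, rfl⟩
      obtain ⟨π, hπ⟩ := hπ
      have hπ0 : π ≠ 0 := by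
        rintro rfl
        rw [norm_zero, zero_pow he] at hπ
        exact (inv_ne_zero (by positivity)) hπ.symm
      refine ⟨(Units.mk0 π hπ0) ^ k, ?_⟩
      have := hord ((Units.mk0 π hπ0) ^ k) (-k) (by
        rw [Units.val_zpow_eq_zpow_val, Units.val_mk0, norm_zpow, ← zpow_natCast, ← zpow_mul,
          mul_comm, zpow_mul, zpow_natCast, hπ, inv_zpow, zpow_neg])
      simpa using this
  have hdvd : ∀ a b : ℕ, 0 < a → 0 < b → Set.range (fun k : ℤ => (k : ℝ) / (a : ℝ)) ⊆
      Set.range (fun k : ℤ => (k : ℝ) / (b : ℝ)) → a ∣ b := by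
    intro a b ha hb hab
    obtain ⟨k, hk⟩ := hab ⟨1, rfl⟩
    have ha' : (a : ℝ) ≠ 0 := by exact_mod_cast ha.ne'
    have hb' : (b : ℝ) ≠ 0 := by exact_mod_cast hb.ne'
    dsimp only at hk
    rw [div_eq_div_iff hb' ha'] at hk
    have hk' : k * (a : ℤ) = b := by
      have : ((k * (a : ℤ) : ℤ) : ℝ) = ((b : ℤ) : ℝ) := by push_cast at hk ⊢; linarith
      exact_mod_cast this
    exact Int.natCast_dvd_natCast.mp ⟨k, by rw [← hk', mul_comm]⟩
  have hset : {e' : ℕ | 0 < e' ∧ Set.range (fun x : Kˣ => ord p x) =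
      Set.range (fun k : ℤ => (k : ℝ) / (e' : ℝ))} = {e} := by
    ext e'
    rw [Set.mem_singleton_iff, Set.mem_ofPred_eq, hrange]
    constructor
    · rintro ⟨h0, h1⟩
      exact Nat.dvd_antisymm (hdvd e' e h0 (Nat.pos_of_ne_zero he) h1.ge)
        (hdvd e e' (Nat.pos_of_ne_zero he) h0 h1.le)
    · rintro rfl
      exact ⟨Nat.pos_of_ne_zero he, rfl⟩
  rw [ramificationIndex, hset, csInf_singleton]

/-- Discreteness gives `‖t‖ ^ e ≤ 1 / p`; since `p - 1 ≥ e + 1`, one more factor `‖t‖` makes `‖t‖ ^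
(p - 1) < 1 / p`. -/
lemma rate_lt_one_of_valueGroup {e : ℕ} (he : e + 1 < p)
    (h : ∀ x : K, x ≠ 0 → ∃ k : ℤ, ‖x‖ ^ e = (p : ℝ) ^ k) {t : K} (ht : ‖t‖ < 1)
    (he0 : e ≠ 0) : ‖t‖ * expRate p < 1 := by
  have hp1 : (1 : ℝ) < p := by exact_mod_cast (Fact.out : p.Prime).one_lt
  rcases eq_or_ne t 0 with rfl | ht0
  · simp
  obtain ⟨k, hk⟩ := h t ht0
  have htp : 0 < ‖t‖ := norm_pos_iff.mpr ht0
  have h1 : (p : ℝ) ^ k < 1 := by rw [← hk]; exact pow_lt_one₀ htp.le ht he0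
  have h2 : k < 0 := by
    by_contra! hk0
    exact absurd h1 (not_lt.mpr (one_le_zpow₀ hp1.le hk0))
  have h3 : ‖t‖ ^ e ≤ (p : ℝ)⁻¹ := by
    rw [hk, ← zpow_neg_one]
    exact zpow_le_zpow_right₀ hp1.le (by omega)
  have h4 : (‖t‖ * expRate p) ^ (p - 1) < 1 := by
    rw [mul_pow, expRate_pow, ← lt_div_iff₀ (by positivity), one_div]
    calc ‖t‖ ^ (p - 1) ≤ ‖t‖ ^ (e + 1) := pow_le_pow_of_le_one htp.le ht.le (by omega)
      _ = ‖t‖ ^ e * ‖t‖ := pow_succ _ _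
      _ < ‖t‖ ^ e := mul_lt_of_lt_one_right (by positivity) ht
      _ ≤ _ := h3
  exact (pow_lt_one_iff_of_nonneg (norm_rate_nonneg p t) (by omega)).mp h4

end ValueGroup

/-! ### Frobenius on residues and Hensel lifting -/

section Residues

variable {p : ℕ} [Fact p.Prime] {K : Type*} [NormedField K] [NormedAlgebra ℚ_[p] K]

lemma exists_norm_eq_zpow {a : ℚ_[p]} (ha : a ≠ 0) :
    ∃ k : ℤ, ‖algebraMap ℚ_[p] K a‖ = (p : ℝ) ^ k :=
  ⟨_, (norm_algebraMap' K a).trans (Padic.norm_eq_zpow_neg_valuation ha)⟩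

lemma exists_int_near {a : ℚ_[p]} (ha : ‖a‖ ≤ 1) :
    ∃ n : ℤ, ‖algebraMap ℚ_[p] K a - n‖ < 1 := by
  obtain ⟨z, rfl⟩ : ∃ z : ℤ_[p], (z : ℚ_[p]) = a := ⟨⟨a, ha⟩, rfl⟩
  obtain ⟨n, -, hn⟩ := PadicInt.exists_mem_range z
  refine ⟨n, ?_⟩
  rw [IsLocalRing.mem_maximalIdeal, PadicInt.mem_nonunits, PadicInt.norm_def, PadicInt.coe_sub,
    PadicInt.coe_natCast] at hn
  rw [← map_intCast (algebraMap ℚ_[p] K), ← map_sub, norm_algebraMap', Int.cast_natCast]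
  exact hn

lemma norm_intCast_eq (n : ℤ) : ‖(n : K)‖ = ‖(n : ℤ_[p])‖ := by
  rw [← map_intCast (algebraMap ℚ_[p] K) n, norm_algebraMap', PadicInt.norm_def]
  simp

lemma norm_intCast_le_one (p : ℕ) [Fact p.Prime] {K : Type*} [NormedField K]
    [NormedAlgebra ℚ_[p] K] (n : ℤ) : ‖(n : K)‖ ≤ 1 := by
  rw [norm_intCast_eq (p := p)]; exact PadicInt.norm_le_one _

lemma norm_intCast_lt_one_iff (n : ℤ) : ‖(n : K)‖ < 1 ↔ (p : ℤ) ∣ n := by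
  rw [norm_intCast_eq (p := p)]; exact PadicInt.norm_int_lt_one_iff_dvd n

variable [IsUltrametricDist K]

lemma norm_pow_prime_sub_self_of_int_near {x : K} (hx : ‖x‖ ≤ 1) {n : ℤ} (hn : ‖x - n‖ < 1) :
    ‖x ^ p - x‖ < 1 := by
  have h1 : ‖x ^ p - (n : K) ^ p‖ < 1 :=
    (norm_pow_sub_pow_le hx (norm_intCast_le_one p n) p).trans_lt hn
  have h2 : ‖((n ^ p - n : ℤ) : K)‖ < 1 := by
    rw [norm_intCast_lt_one_iff (p := p), ← ZMod.intCast_zmod_eq_zero_iff_dvd]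
    push_cast
    rw [ZMod.pow_card, sub_self]
  have h3 : x ^ p - x = (x ^ p - (n : K) ^ p) + ((n ^ p - n : ℤ) : K) - (x - n) := by
    push_cast; ring
  rw [h3]
  exact norm_sub_lt (norm_add_lt h1 h2) hn

/-- Modulo the maximal ideal `φ ^ p` is again a root of `X² - X - 1`, hence congruent to `φ` or
`φ'`. Either way a second `p`-th power returns to `φ`. -/
lemma norm_golden_pow_prime_sq_sub_self {φ φ' : K} (hφ : φ ^ 2 - φ - 1 = 0)
    (hφ' : φ' ^ 2 - φ' - 1 = 0) (hne : φ' ≠ φ) (hp : p ≠ 2) : ‖φ ^ p ^ 2 - φ‖ < 1 := by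
  have hadd := golden_add_eq_one hφ hφ' hne
  have hmul := golden_mul_eq_neg_one hφ hφ' hne
  have h1 := (norm_golden hφ).le
  have h1' := (norm_golden hφ').le
  obtain ⟨r, hr, hr'⟩ := exists_add_pow_prime_eq_of_norm_le_one (p := p) h1 h1'
  rw [hadd, one_pow] at hr'
  have hab : φ ^ p * φ' ^ p = -1 := by
    rw [← mul_pow, hmul, ((Fact.out : p.Prime).odd_of_ne_two hp).neg_one_pow]
  have hsum : ‖φ ^ p + φ' ^ p - 1‖ < 1 := by
    have : φ ^ p + φ' ^ p - 1 = -(p * φ * φ' * r) := by rw [hr']; ring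
    rw [this, norm_neg, norm_mul, norm_mul, norm_mul, norm_golden hφ, norm_golden hφ', mul_one,
      mul_one]
    exact (mul_le_of_le_one_right (norm_nonneg _) hr).trans_lt (norm_prime_lt_one p K)
  have ha : ‖φ ^ p‖ = 1 := by rw [norm_pow, norm_golden hφ, one_pow]
  have hprod : ‖φ ^ p - φ‖ * ‖φ ^ p - φ'‖ < 1 := by
    have : (φ ^ p - φ) * (φ ^ p - φ') = φ ^ p * (φ ^ p + φ' ^ p - 1) := by
      linear_combination -φ ^ p * hadd + hmul - hab
    rw [← norm_mul, this, norm_mul, ha, one_mul]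
    exact hsum
  have hor : ‖φ ^ p - φ‖ < 1 ∨ ‖φ ^ p - φ'‖ < 1 := by
    by_contra! h
    exact absurd hprod (not_lt.mpr (one_le_mul_of_one_le_of_one_le h.1 h.2))
  rw [pow_two, pow_mul]
  rcases hor with h | h
  · have h3 := (norm_pow_sub_pow_le ha.le h1 p).trans_lt h
    rw [← sub_add_sub_cancel _ (φ ^ p)]
    exact norm_add_lt h3 h
  · have h3 := (norm_pow_sub_pow_le ha.le h1' p).trans_lt h
    have h4 : (φ ^ p) ^ p - φ = ((φ ^ p) ^ p - φ' ^ p) + ((φ ^ p + φ' ^ p - 1) - (φ ^ p - φ')) := by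
      linear_combination -hadd
    rw [h4]
    exact norm_add_lt h3 (norm_sub_lt hsum h)

/-- Hensel's lemma applies at `n`: `(2n - 1)² = 4(n² - n - 1) + 5`, so the derivative is a unit
unless `p = 5`. The lifted root is `φ` or `1 - φ`. -/
lemma mem_range_of_int_near {φ : K} (hφ : φ ^ 2 - φ - 1 = 0) (hp5 : p ≠ 5) {n : ℤ}
    (hn : ‖φ - n‖ < 1) : φ ∈ (algebraMap ℚ_[p] K).range := by
  have hφ' : (1 - φ) ^ 2 - (1 - φ) - 1 = 0 := by linear_combination hφ
  have hval : ‖((n ^ 2 - n - 1 : ℤ) : K)‖ < 1 := by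
    have : ((n ^ 2 - n - 1 : ℤ) : K) = (φ - n) * ((1 - φ) - n) := by
      push_cast; linear_combination hφ
    rw [this, norm_mul]
    have h2 : ‖1 - φ - n‖ ≤ 1 := (norm_sub_le_max' _ _).trans
      (max_le (norm_golden_le_one hφ') (norm_intCast_le_one p n))
    exact (mul_le_of_le_one_right (norm_nonneg _) h2).trans_lt hn
  have hder : ‖((2 * n - 1 : ℤ) : ℤ_[p])‖ = 1 := by
    refine le_antisymm (PadicInt.norm_le_one _) (not_lt.mp fun h => hp5 ?_)
    rw [PadicInt.norm_int_lt_one_iff_dvd] at h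
    rw [norm_intCast_lt_one_iff (p := p)] at hval
    have h5 : (p : ℤ) ∣ 5 := by
      have : (5 : ℤ) = (2 * n - 1) * (2 * n - 1) - (n ^ 2 - n - 1) * 4 := by ring
      rw [this]
      exact dvd_sub (h.mul_right _) (hval.mul_right _)
    have h6 : p ∣ 5 := by exact_mod_cast h5
    exact (Nat.prime_dvd_prime_iff_eq Fact.out Nat.prime_five).mp h6
  rw [norm_intCast_eq (p := p)] at hval
  obtain ⟨z, hz, -⟩ := hensels_lemma (p := p)
    (F := (Polynomial.X ^ 2 - Polynomial.X - 1 : Polynomial ℤ_[p])) (a := (n : ℤ_[p])) (by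
      have h1 : ((2 * n - 1 : ℤ) : ℤ_[p]) = 2 * n - 1 := by push_cast; ring
      have h2 : ((n ^ 2 - n - 1 : ℤ) : ℤ_[p]) = n ^ 2 - n - 1 := by push_cast; ring
      rw [h1] at hder
      rw [h2] at hval
      simpa [hder, one_add_one_eq_two] using hval)
  have hz' : z ^ 2 - z - 1 = 0 := by simpa using hz
  have hzK : intEmb p K z ^ 2 - intEmb p K z - 1 = 0 := by
    have := congrArg (intEmb p K) hz'
    simpa using this
  have hfac : (φ - intEmb p K z) * (φ - (1 - intEmb p K z)) = 0 := by
    linear_combination hφ - hzK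
  rcases mul_eq_zero.mp hfac with h | h
  · exact ⟨z, (sub_eq_zero.mp h).symm⟩
  · refine ⟨1 - z, ?_⟩
    rw [map_sub, map_one]
    exact (sub_eq_zero.mp h).symm

end Residues

/-! ### Degree and value group of `ℚ_p(φ)` -/

section Degree

variable {p : ℕ} [Fact p.Prime] {K : Type*} [NormedField K] [NormedAlgebra ℚ_[p] K] {φ : K}

open Polynomial in
lemma golden_aeval (hφ : φ ^ 2 - φ - 1 = 0) : aeval φ (X ^ 2 - X - 1 : ℚ_[p][X]) = 0 := by
  simpa using hφ

open Polynomial in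
lemma golden_monic : (X ^ 2 - X - 1 : ℚ_[p][X]).Monic := by monicity!

open Polynomial in
lemma golden_natDegree : (X ^ 2 - X - 1 : ℚ_[p][X]).natDegree = 2 := by compute_degree!

lemma golden_isIntegral (hφ : φ ^ 2 - φ - 1 = 0) : IsIntegral ℚ_[p] φ :=
  ⟨_, golden_monic, golden_aeval hφ⟩

lemma finiteDimensional_of_adjoin_golden (hφ : φ ^ 2 - φ - 1 = 0)
    (hK : IntermediateField.adjoin ℚ_[p] {φ} = ⊤) : FiniteDimensional ℚ_[p] K := by
  have h := IntermediateField.adjoin.finiteDimensional (golden_isIntegral (p := p) hφ)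
  rw [hK] at h
  exact Module.Finite.equiv (IntermediateField.topEquiv (F := ℚ_[p]) (E := K)).toLinearEquiv

lemma finrank_of_mem_range (hK : IntermediateField.adjoin ℚ_[p] {φ} = ⊤)
    (h : φ ∈ (algebraMap ℚ_[p] K).range) : Module.finrank ℚ_[p] K = 1 := by
  rw [← IntermediateField.finrank_top', ← hK, IntermediateField.finrank_adjoin_simple_eq_one_iff]
  exact IntermediateField.mem_bot.mpr h

lemma finrank_of_not_mem_range (hφ : φ ^ 2 - φ - 1 = 0)
    (hK : IntermediateField.adjoin ℚ_[p] {φ} = ⊤)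
    (h : φ ∉ (algebraMap ℚ_[p] K).range) : Module.finrank ℚ_[p] K = 2 := by
  have hint := golden_isIntegral (p := p) hφ
  rw [← IntermediateField.finrank_top', ← hK, IntermediateField.adjoin.finrank hint]
  refine le_antisymm ?_ ((minpoly.two_le_natDegree_iff hint).mpr h)
  have h1 := Polynomial.natDegree_le_of_dvd (minpoly.dvd ℚ_[p] φ (golden_aeval hφ))
    golden_monic.ne_zero
  rwa [golden_natDegree] at h1

lemma exists_eq_add_mul_golden (hφ : φ ^ 2 - φ - 1 = 0)
    (hK : IntermediateField.adjoin ℚ_[p] {φ} = ⊤) (x : K) :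
    ∃ a b : ℚ_[p], x = algebraMap ℚ_[p] K a + algebraMap ℚ_[p] K b * φ := by
  have h := IntermediateField.adjoin_simple_toSubalgebra_of_isAlgebraic
    (golden_isIntegral (p := p) hφ).isAlgebraic
  rw [hK, IntermediateField.top_toSubalgebra] at h
  have hx : x ∈ Algebra.adjoin ℚ_[p] {φ} := by rw [← h]; exact Algebra.mem_top
  induction hx using Algebra.adjoin_induction with
  | mem x hx => rw [Set.mem_singleton_iff.mp hx]; exact ⟨0, 1, by simp⟩
  | algebraMap r => exact ⟨r, 0, by simp⟩
  | add x y _ _ hx hy =>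
    obtain ⟨a, b, rfl⟩ := hx
    obtain ⟨c, d, rfl⟩ := hy
    exact ⟨a + c, b + d, by simp only [map_add]; ring⟩
  | mul x y _ _ hx hy =>
    obtain ⟨a, b, rfl⟩ := hx
    obtain ⟨c, d, rfl⟩ := hy
    refine ⟨a * c + b * d, a * d + b * c + b * d, ?_⟩
    simp only [map_add, map_mul]
    linear_combination algebraMap ℚ_[p] K b * algebraMap ℚ_[p] K d * hφ

lemma valueGroup_of_mem_range (hφ : φ ^ 2 - φ - 1 = 0)
    (hK : IntermediateField.adjoin ℚ_[p] {φ} = ⊤) (h : φ ∈ (algebraMap ℚ_[p] K).range)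
    (x : K) (hx : x ≠ 0) : ∃ k : ℤ, ‖x‖ = (p : ℝ) ^ k := by
  obtain ⟨c, rfl⟩ := h
  obtain ⟨a, b, rfl⟩ := exists_eq_add_mul_golden hφ hK x
  rw [← map_mul, ← map_add] at hx ⊢
  exact exists_norm_eq_zpow fun h0 => hx (by rw [h0, map_zero])

variable [IsUltrametricDist K]

/-- Up to a scalar an element is `φ - c`. If `c` is integral this is a unit, as `φ` is congruent to
no integer; otherwise `c` dominates. -/
lemma valueGroup_of_unramified (hφ : φ ^ 2 - φ - 1 = 0)
    (hK : IntermediateField.adjoin ℚ_[p] {φ} = ⊤) (h : ∀ n : ℤ, 1 ≤ ‖φ - n‖)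
    (x : K) (hx : x ≠ 0) : ∃ k : ℤ, ‖x‖ = (p : ℝ) ^ k := by
  obtain ⟨a, b, rfl⟩ := exists_eq_add_mul_golden hφ hK x
  rcases eq_or_ne b 0 with rfl | hb
  · rw [map_zero, zero_mul, add_zero] at hx ⊢
    exact exists_norm_eq_zpow fun h0 => hx (by rw [h0, map_zero])
  have hb' : algebraMap ℚ_[p] K b ≠ 0 := (map_ne_zero _).mpr hb
  set c := -a / b with hc
  have hfac : algebraMap ℚ_[p] K a + algebraMap ℚ_[p] K b * φ =
      algebraMap ℚ_[p] K b * (φ - algebraMap ℚ_[p] K c) := by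
    rw [hc, map_div₀, map_neg]; field_simp; ring
  obtain ⟨l, hl⟩ := exists_norm_eq_zpow (K := K) hb
  have hp0 : (p : ℝ) ≠ 0 := by exact_mod_cast (Fact.out : p.Prime).ne_zero
  rw [hfac, norm_mul, hl]
  rcases le_or_gt ‖c‖ 1 with h1 | h1
  · obtain ⟨n, hn⟩ := exists_int_near (K := K) h1
    refine ⟨l, ?_⟩
    have h2 : ‖φ - algebraMap ℚ_[p] K c‖ = 1 := by
      refine le_antisymm ?_ (not_lt.mp fun h3 => ?_)
      · exact (norm_sub_le_max' _ _).trans (max_le (norm_golden_le_one hφ)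
          (by rwa [norm_algebraMap']))
      · refine absurd (h n) (not_le.mpr ?_)
        rw [← sub_add_sub_cancel φ (algebraMap ℚ_[p] K c)]
        exact norm_add_lt h3 hn
    rw [h2, mul_one]
  · have hc0 : c ≠ 0 := by rintro h0; rw [h0, norm_zero] at h1; linarith
    obtain ⟨k, hk⟩ := exists_norm_eq_zpow (K := K) hc0
    have h2 : ‖φ - algebraMap ℚ_[p] K c‖ = ‖algebraMap ℚ_[p] K c‖ := by
      rw [norm_sub_rev]
      refine norm_eq_of_norm_sub_lt ?_
      rw [sub_sub_cancel_left, norm_neg, norm_golden hφ, norm_algebraMap']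
      exact h1
    exact ⟨l + k, by rw [h2, hk, zpow_add₀ hp0]⟩

omit [IsUltrametricDist K] in
lemma sq_norm_sqrt_five (hp5 : p = 5) (hφ : φ ^ 2 - φ - 1 = 0) :
    ‖2 * φ - 1‖ ^ 2 = (p : ℝ)⁻¹ := by
  have h : (2 * φ - 1) ^ 2 = (p : K) := by
    rw [hp5]; push_cast; linear_combination 4 * hφ
  rw [← norm_pow, h, norm_prime]

lemma valueGroup_of_eq_five (hp5 : p = 5) (hφ : φ ^ 2 - φ - 1 = 0)
    (hK : IntermediateField.adjoin ℚ_[p] {φ} = ⊤)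
    (x : K) (hx : x ≠ 0) : ∃ k : ℤ, ‖x‖ ^ 2 = (p : ℝ) ^ k := by
  have := charZero_of_normedAlgebra p K
  have hp1 : (1 : ℝ) < p := by exact_mod_cast (Fact.out : p.Prime).one_lt
  have hp0 : (p : ℝ) ≠ 0 := by positivity
  have hs := sq_norm_sqrt_five hp5 hφ
  obtain ⟨a, b, hab⟩ := exists_eq_add_mul_golden hφ hK x
  -- In the basis `1, √5` the squared norms of the two terms are even and odd powers of `p`, so they
  -- never tie.
  obtain ⟨c, d, hcd⟩ : ∃ c d : ℚ_[p],
      x = algebraMap ℚ_[p] K c + algebraMap ℚ_[p] K d * (2 * φ - 1) := by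
    refine ⟨a + b / 2, b / 2, ?_⟩
    rw [hab, map_add, map_div₀, map_ofNat]
    ring
  have hsq : ∀ {c : ℚ_[p]}, c ≠ 0 → ∃ k : ℤ, ‖algebraMap ℚ_[p] K c‖ ^ 2 = (p : ℝ) ^ (2 * k) := by
    intro c hc
    obtain ⟨k, hk⟩ := exists_norm_eq_zpow (K := K) hc
    exact ⟨k, by rw [hk, mul_comm, zpow_mul, zpow_ofNat]⟩
  have hsq' : ∀ {d : ℚ_[p]}, d ≠ 0 →
      ∃ k : ℤ, ‖algebraMap ℚ_[p] K d * (2 * φ - 1)‖ ^ 2 = (p : ℝ) ^ (2 * k - 1) := by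
    intro d hd
    obtain ⟨k, hk⟩ := hsq hd
    exact ⟨k, by rw [norm_mul, mul_pow, hs, hk, zpow_sub_one₀ hp0]⟩
  subst hcd
  rcases eq_or_ne c 0 with rfl | hc
  · rw [map_zero, zero_add] at hx ⊢
    obtain ⟨k, hk⟩ := hsq' (d := d) (by rintro rfl; simp at hx)
    exact ⟨_, hk⟩
  rcases eq_or_ne d 0 with rfl | hd
  · rw [map_zero, zero_mul, add_zero]
    obtain ⟨k, hk⟩ := hsq hc
    exact ⟨_, hk⟩
  obtain ⟨k, hk⟩ := hsq hc
  obtain ⟨l, hl⟩ := hsq' hd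
  have hne : ‖algebraMap ℚ_[p] K c‖ ≠ ‖algebraMap ℚ_[p] K d * (2 * φ - 1)‖ := by
    intro h
    rw [h, hl] at hk
    have := zpow_right_injective₀ (by positivity) hp1.ne' hk
    omega
  rw [IsUltrametricDist.norm_add_eq_max_of_norm_ne_norm hne]
  rcases max_choice ‖algebraMap ℚ_[p] K c‖ ‖algebraMap ℚ_[p] K d * (2 * φ - 1)‖ with h | h
  · exact ⟨_, h ▸ hk⟩
  · exact ⟨_, h ▸ hl⟩

end Degree

end PadicInterp

/-! ### The three cases: split, ramified, unramified -/

theorem theorem5p2 (p : ℕ) [Fact p.Prime] (hp : p ≠ 2)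
    {K : Type*} [NormedField K] [NormedAlgebra ℚ_[p] K]
    (φ φ' : K) (hφ : φ ^ 2 - φ - 1 = 0) (hφ' : φ' ^ 2 - φ' - 1 = 0) (hne : φ' ≠ φ)
    (hK : IntermediateField.adjoin ℚ_[p] {φ} = ⊤) :
    -- the roots of unity exist, and the logarithm is evaluated inside its domain
    (PadicInterp.IsRootCongruentTo p φ (PadicInterp.omega p φ) ∧
      PadicInterp.IsRootCongruentTo p φ' (PadicInterp.omega p φ') ∧
      ‖φ / PadicInterp.omega p φ - 1‖ < 1 ∧
      Summable (PadicInterp.logTerm (φ / PadicInterp.omega p φ))) ∧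
    -- the series converge, and the functions take values in `ℤ_[p]`
    (∀ i : ℕ, i < p ^ PadicInterp.residueDegree p K - 1 → ∀ x : ℤ_[p],
      Summable (PadicInterp.fibTerm p φ φ' i x) ∧
      ∃ y : ℤ_[p], PadicInterp.fibInterp p φ φ' i x = PadicInterp.intEmb p K y) ∧
    PadicInterp.IsTwistedInterpolation p 1 (fun n : ℕ => (Nat.fib n : ℤ_[p]))
      (fun i : Fin (p ^ PadicInterp.residueDegree p K - 1) => PadicInterp.fibInterp p φ φ' i)
      (fun i : Fin (p ^ PadicInterp.residueDegree p K - 1) =>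
        {n : ℕ | n ≡ i [MOD p ^ PadicInterp.residueDegree p K - 1]}) := by
  have := PadicInterp.isUltrametricDist_of_normedAlgebra p K
  have := PadicInterp.finiteDimensional_of_adjoin_golden hφ hK
  have hp3 : 1 + 1 < p := lt_of_le_of_ne (Fact.out : p.Prime).two_le hp.symm
  have hadd := PadicInterp.golden_add_eq_one hφ hφ' hne
  have hfrob : ∀ n : ℤ, ‖φ - n‖ < 1 → ‖φ ^ p ^ 1 - φ‖ < 1 ∧ ‖φ' ^ p ^ 1 - φ'‖ < 1 := by
    intro n hn
    rw [pow_one]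
    refine ⟨PadicInterp.norm_pow_prime_sub_self_of_int_near (PadicInterp.norm_golden hφ).le hn,
      PadicInterp.norm_pow_prime_sub_self_of_int_near (n := 1 - n)
        (PadicInterp.norm_golden hφ').le ?_⟩
    have : φ' - ((1 - n : ℤ) : K) = -(φ - n) := by push_cast; linear_combination hadd
    rwa [this, norm_neg]
  have hunif : ∃ π : K, ‖π‖ ^ 1 = (p : ℝ)⁻¹ :=
    ⟨p, by rw [pow_one, PadicInterp.norm_prime]⟩
  obtain ⟨hf, hrate, hq, hq'⟩ : PadicInterp.residueDegree p K ≠ 0 ∧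
      (∀ t : K, ‖t‖ < 1 → ‖t‖ * PadicInterp.expRate p < 1) ∧
      ‖φ ^ p ^ PadicInterp.residueDegree p K - φ‖ < 1 ∧
      ‖φ' ^ p ^ PadicInterp.residueDegree p K - φ'‖ < 1 := by
    -- The cases have `(d, e, f)` equal to `(1, 1, 1)`, `(2, 2, 1)` and `(2, 1, 2)`.
    by_cases hmem : φ ∈ (algebraMap ℚ_[p] K).range
    · have hv : ∀ x : K, x ≠ 0 → ∃ k : ℤ, ‖x‖ ^ 1 = (p : ℝ) ^ k := by
        simpa only [pow_one] using PadicInterp.valueGroup_of_mem_range hφ hK hmem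
      have hf : PadicInterp.residueDegree p K = 1 := by
        rw [PadicInterp.residueDegree, PadicInterp.ramificationIndex_eq one_ne_zero hv hunif,
          PadicInterp.finrank_of_mem_range hK hmem, Nat.div_one]
      obtain ⟨c, hc⟩ := hmem
      obtain ⟨n, hn⟩ := PadicInterp.exists_int_near (K := K) (a := c) (by
        rw [← norm_algebraMap' K, hc]; exact (PadicInterp.norm_golden hφ).le)
      rw [hc] at hn
      rw [hf]
      exact ⟨one_ne_zero, fun t ht =>
        PadicInterp.rate_lt_one_of_valueGroup hp3 hv ht one_ne_zero, hfrob n hn⟩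
    by_cases hp5 : p = 5
    · have hv := PadicInterp.valueGroup_of_eq_five hp5 hφ hK
      have hs := PadicInterp.sq_norm_sqrt_five hp5 hφ
      have hf : PadicInterp.residueDegree p K = 1 := by
        rw [PadicInterp.residueDegree, PadicInterp.ramificationIndex_eq two_ne_zero hv ⟨_, hs⟩,
          PadicInterp.finrank_of_not_mem_range hφ hK hmem]
      rw [hf]
      refine ⟨one_ne_zero, fun t ht =>
        PadicInterp.rate_lt_one_of_valueGroup (by omega) hv ht two_ne_zero, hfrob 3 ?_⟩
      -- `3` is the double root of `X² - X - 1` modulo `5`.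
      have h1 : φ - (3 : ℤ) = (3 : ℤ) * (2 * φ - 1) - (p : K) * φ := by
        rw [hp5]; push_cast; ring
      have hs1 : ‖2 * φ - 1‖ < 1 := by
        rw [← pow_lt_one_iff_of_nonneg (norm_nonneg _) two_ne_zero, hs,
          ← PadicInterp.norm_prime p K]
        exact PadicInterp.norm_prime_lt_one p K
      rw [h1]
      refine PadicInterp.norm_sub_lt ?_ ?_
      · rw [norm_mul]
        exact (mul_le_of_le_one_left (norm_nonneg _)
          (PadicInterp.norm_intCast_le_one p 3)).trans_lt hs1
      · rw [norm_mul, PadicInterp.norm_golden hφ, mul_one]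
        exact PadicInterp.norm_prime_lt_one p K
    · have hv : ∀ x : K, x ≠ 0 → ∃ k : ℤ, ‖x‖ ^ 1 = (p : ℝ) ^ k := by
        simpa only [pow_one] using PadicInterp.valueGroup_of_unramified hφ hK fun n =>
          not_lt.mp fun hn => hmem (PadicInterp.mem_range_of_int_near hφ hp5 hn)
      have hf : PadicInterp.residueDegree p K = 2 := by
        rw [PadicInterp.residueDegree, PadicInterp.ramificationIndex_eq one_ne_zero hv hunif,
          PadicInterp.finrank_of_not_mem_range hφ hK hmem, Nat.div_one]
      rw [hf]
      exact ⟨two_ne_zero, fun t ht =>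
        PadicInterp.rate_lt_one_of_valueGroup hp3 hv ht one_ne_zero,
        PadicInterp.norm_golden_pow_prime_sq_sub_self hφ hφ' hne hp,
        PadicInterp.norm_golden_pow_prime_sq_sub_self hφ' hφ hne.symm hp⟩
  exact PadicInterp.fib_twistedInterpolation_of_residueDegree hp hφ hφ' hne hf hrate hq hq'
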